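/- Let $1<p<\infty$, $p'=p/(p-1)$. A weight is a locally integrable function $w:\mathbb R\to\mathbb R$ that is positive a.e.; we write $w(A)=\int_A w\,dx$. Below, $Q$ denotes a cube in $\mathbb R$, i.e. a bounded interval with non-empty interior (with or without its endpoints), and $f:\mathbb R\to\mathbb C$ is measurable. Let $$\|f\|_{L^{p,1}(w)}=\int_0^\infty w(\{|f|>y\})^{1/p}\,dy,\qquad \|f\|_{L^{p,\infty}(w)}=\sup_{y>0}\,y\,w(\{|f|>y\})^{1/p}.$$ For a weight $u$ put $\mathcal M_uf(x)=\sup_{Q\ni x}\frac1{u(Q)}\int_Q|f|u\,dx$. For weights $u,w$ we write $w\in A_p(u)$ if $\mathcal M_u$ is bounded on $L^p(wu)$, and $w\in A_p^{\mathcal R}(u)$ if $\mathcal M_u$ is bounded from $L^{p,1}(wu)$ to $L^{p,\infty}(wu)$. Moreover $A_\infty=\bigcup_{1\le q<\infty}A_q$, where $w\in A_q$ means that $\mathcal M_1$ (the Hardy–Littlewood maximal operator) is bounded on $L^q(w)$ if $q>1$, and from $L^1(w)$ to $L^{1,\infty}(w)$ if $q=1$. For $0<\eta<1$, a family $\mathcal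 S$ of cubes is $\eta$-sparse if there are pairwise disjoint measurable sets $E_Q\subset Q$ ($Q\in\mathcal S$) with $|E_Q|\ge\eta|Q|$; the sparse operator is $\mathcal A_{\mathcal S}g=\sum_{Q\in\mathcal S}\big(\frac1{|Q|}\int_Qg\,dx\big)\mathbf 1_Q$. **Theorem.** Let $u,v$ be weights with $v\in A_\infty$ and $$\sup_Q\frac{u(Q)\,\left(\frac vu\right)(Q)}{|Q|\,v(Q)}<\infty .$$ Suppose that either $\frac vu\in A_p(u)$ and $u\in A_{p'}^{\mathcal R}\left(\frac vu\right)$, or $\frac vu\in A_p^{\mathcal R}(u)$ and $u\in A_{p'}\left(\frac vu\right)$. Then $(u,v)\in\mathcal S_p^{\mathcal R}$; that is, for every $\eta\in(0,1)$ there is a constant $C<\infty$ such that for every $\eta$-sparse family $\mathcal S$ and every $f\in L^{p,1}(v)$, the function $fu$ is integrable on each $Q\in\mathcal S$, the series defining $\mathcal A_{\mathcal S}(fu)$ converges absolutely a.e., and $$\left\|\frac{\mathcal A_{\mathcal S}(fu)}u\right\|_{L^{p,\infty}(v)}\le C\,\|f\|_{L^{p,1}(v)} .$$ -/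

import Mathlib

open MeasureTheory Set
open scoped ENNReal NNReal

noncomputable section

namespace SparseWeights

/-- A weight on `ℝ`: a locally integrable function which is positive almost everywhere. -/
def IsWeight (w : ℝ → ℝ) : Prop :=
  LocallyIntegrable w volume ∧ ∀ᵐ x ∂(volume : Measure ℝ), 0 < w x

/-- The measure `w(A) = ∫_A w dx`. -/
def wMeasure (w : ℝ → ℝ) : Measure ℝ :=
  volume.withDensity (fun x => ENNReal.ofReal (w x))

/-- The cubes of `ℝ`: bounded intervals with non-empty interior, which may or may not contain
their endpoints. -/
def IsCube (Q : Set ℝ) : Prop :=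
  ∃ a b : ℝ, a < b ∧ Ioo a b ⊆ Q ∧ Q ⊆ Icc a b

/-- The (uncentred) maximal operator with respect to `μ`:
`M_μ f (x) = sup_{Q ∋ x} μ(Q)⁻¹ ∫_Q |f| dμ`. -/
def maximalFun (μ : Measure ℝ) (f : ℝ → ℂ) (x : ℝ) : ℝ≥0∞ :=
  ⨆ (Q : Set ℝ) (_ : IsCube Q ∧ x ∈ Q), (∫⁻ y in Q, ‖f y‖ₑ ∂μ) / μ Q

/-- The distribution function `λ_f(y) = μ({|f| > y})`. -/
def distrib {ε : Type*} [ENorm ε] (f : ℝ → ε) (μ : Measure ℝ) (y : ℝ≥0) : ℝ≥0∞ :=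
  μ {x | (y : ℝ≥0∞) < ‖f x‖ₑ}

/-- The Lorentz norm of `L^{p,1}(μ)`: `∫₀^∞ λ_f(y)^{1/p} dy`. -/
def lorentzOne {ε : Type*} [ENorm ε] (f : ℝ → ε) (p : ℝ) (μ : Measure ℝ) : ℝ≥0∞ :=
  ∫⁻ y in Ioi (0 : ℝ), (distrib f μ y.toNNReal) ^ (1 / p)

/-- The quasi-norm of `L^{p,∞}(μ)`: `sup_{y > 0} y λ_f(y)^{1/p}`. -/
def lorentzWeak {ε : Type*} [ENorm ε] (f : ℝ → ε) (p : ℝ) (μ : Measure ℝ) : ℝ≥0∞ :=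
  ⨆ (y : ℝ≥0) (_ : 0 < y), (y : ℝ≥0∞) * (distrib f μ y) ^ (1 / p)

/-- `f ∈ L^{p,1}(μ)` (with `μ` having a density with respect to Lebesgue measure). -/
def MemLorentzOne (f : ℝ → ℂ) (p : ℝ) (μ : Measure ℝ) : Prop :=
  AEMeasurable f volume ∧ lorentzOne f p μ < ∞

/-- The maximal operator `M_σ` is bounded from `L^p(μ)` to `L^p(μ)`. -/
def MaximalStrong (σ : Measure ℝ) (p : ℝ) (μ : Measure ℝ) : Prop :=
  ∃ C : ℝ≥0, ∀ f : ℝ → ℂ, AEMeasurable f volume → eLpNorm f (ENNReal.ofReal p) μ < ∞ →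
    eLpNorm (maximalFun σ f) (ENNReal.ofReal p) μ ≤ C * eLpNorm f (ENNReal.ofReal p) μ

/-- The maximal operator `M_σ` is bounded from `L^p(μ)` to `L^{p,∞}(μ)`. -/
def MaximalWeak (σ : Measure ℝ) (p : ℝ) (μ : Measure ℝ) : Prop :=
  ∃ C : ℝ≥0, ∀ f : ℝ → ℂ, AEMeasurable f volume → eLpNorm f (ENNReal.ofReal p) μ < ∞ →
    lorentzWeak (maximalFun σ f) p μ ≤ C * eLpNorm f (ENNReal.ofReal p) μ

/-- The maximal operator `M_σ` is bounded from `L^{p,1}(μ)` to `L^{p,∞}(μ)`. -/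
def MaximalRestricted (σ : Measure ℝ) (p : ℝ) (μ : Measure ℝ) : Prop :=
  ∃ C : ℝ≥0, ∀ f : ℝ → ℂ, MemLorentzOne f p μ →
    lorentzWeak (maximalFun σ f) p μ ≤ C * lorentzOne f p μ

/-- The class `A_1`: the Hardy–Littlewood operator is bounded from `L^1(w)` to `L^{1,∞}(w)`. -/
def MemAOne (w : ℝ → ℝ) : Prop :=
  IsWeight w ∧ MaximalWeak volume 1 (wMeasure w)

/-- The class `A_p`, `1 < p < ∞`: the Hardy–Littlewood operator is bounded on `L^p(w)`. -/
def MemAp (p : ℝ) (w : ℝ → ℝ) : Prop :=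
  IsWeight w ∧ MaximalStrong volume p (wMeasure w)

/-- The class `A_∞`, the union of the classes `A_p`, `1 ≤ p < ∞`. -/
def MemAInfty (w : ℝ → ℝ) : Prop :=
  MemAOne w ∨ ∃ p : ℝ, 1 < p ∧ MemAp p w

/-- `w ∈ A_p(u)`: the operator `M_u` is bounded on `L^p(wu)`. -/
def MemApRel (p : ℝ) (u w : ℝ → ℝ) : Prop :=
  IsWeight u ∧ IsWeight w ∧
    MaximalStrong (wMeasure u) p (wMeasure fun x => w x * u x)

/-- `w ∈ A_p^R(u)`: the operator `M_u` is bounded from `L^{p,1}(wu)` to `L^{p,∞}(wu)`. -/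
def MemApRestrictedRel (p : ℝ) (u w : ℝ → ℝ) : Prop :=
  IsWeight u ∧ IsWeight w ∧
    MaximalRestricted (wMeasure u) p (wMeasure fun x => w x * u x)

/-- `S` is an `η`-sparse family of cubes. -/
def IsSparse (η : ℝ) (S : Set (Set ℝ)) : Prop :=
  (∀ Q ∈ S, IsCube Q) ∧
    ∃ E : Set ℝ → Set ℝ,
      (∀ Q ∈ S, E Q ⊆ Q ∧ NullMeasurableSet (E Q) volume ∧
        ENNReal.ofReal η * volume Q ≤ volume (E Q)) ∧
      S.PairwiseDisjoint E

/-- The term `(|Q|⁻¹ ∫_Q f) 1_Q(x)` of a sparse operator. -/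
def sparseTerm (f : ℝ → ℂ) (x : ℝ) (Q : Set ℝ) : ℂ :=
  Q.indicator (fun _ => ⨍ y in Q, f y) x

/-- The sparse operator `A_S f (x) = ∑_{Q ∈ S} (|Q|⁻¹ ∫_Q f) 1_Q(x)`. -/
def sparseOp (S : Set (Set ℝ)) (f : ℝ → ℂ) (x : ℝ) : ℂ :=
  ∑' Q : S, sparseTerm f x Q

/-- The class `S_p^R` of pairs of weights `(u, v)`: for each `0 < η < 1`, the operators
`f ↦ A_S(fu)/u`, with `S` an `η`-sparse family, are well defined on `L^{p,1}(v)` (the averages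
are of integrable functions and the series converges absolutely almost everywhere) and bounded
from `L^{p,1}(v)` to `L^{p,∞}(v)`, with a constant that does not depend on `S`. -/
def MemSpR (p : ℝ) (u v : ℝ → ℝ) : Prop :=
  IsWeight u ∧ IsWeight v ∧
    ∀ η : ℝ, 0 < η → η < 1 → ∃ C : ℝ≥0, ∀ S : Set (Set ℝ), IsSparse η S →
      ∀ f : ℝ → ℂ, MemLorentzOne f p (wMeasure v) →
        (∀ Q ∈ S, IntegrableOn (fun x => f x * (u x : ℂ)) Q volume) ∧
        (∀ᵐ x ∂(volume : Measure ℝ),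
          Summable fun Q : S => sparseTerm (fun y => f y * (u y : ℂ)) x Q) ∧
        lorentzWeak (fun x => sparseOp S (fun y => f y * (u y : ℂ)) x / (u x : ℂ)) p (wMeasure v)
          ≤ C * lorentzOne f p (wMeasure v)

end SparseWeights

end

/-! Write `σ = v/u` and let `q` be the exponent conjugate to `p`. Testing `A_S(fu)/u` against `1_F
v` turns the claim into a bound by `v(E)^{1/p} v(F)^{1/q}` for the form `∑ u(E ∩ Q) σ(F ∩ Q) / |Q|`.
Passing from `1_E` to `f` costs nothing: the `L^{p,1}` norm is the integral of `v({|f| > t})^{1/p}`,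
and the form is additive over layers (`tsum_sparse_le_lorentzOne`, `memSpR_of_bilinear`).

The supremum condition replaces `u(Q) σ(Q) / |Q|` by `v(Q)`, and `v ∈ A_∞` replaces `v(Q)` by
`v(E_Q)` with the `E_Q` disjoint. The form is then at most a constant times `∫ M_u(1_E) M_σ(1_F) v`
(`tsum_sparse_le_lintegral`). Both maximal operators act on spaces over the same measure `v`, since
`σu = v`.

Suppose that `M_u` has the strong bound. By Lorentz duality it remains to see that `M_u(1_E)` lies
in `L^{p,1}(v)` with norm at most `C v(E)^{1/p}`, whereas `L^p` boundedness alone gives only `L^p`.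
The gain comes from iteration. On `L_k = {M_u 1_E > 2⁻ᵏ}` each further application of `M_u` wins a
factor of order `k`, so the third iterate is at least of order `k² 2⁻ᵏ` there. Its `L^p` bound
yields `2⁻ᵏ v(L_k)^{1/p} ≤ C v(E)^{1/p} / k²`, which is summable; two iterates would leave the
harmonic series. The factor `k` rests on a reverse weak type inequality (`le_measure_level_inter`),
valid on the line without any doubling because components of open sets are intervals. -/

namespace SparseWeights

open Filter Topology

/-! ### Cubes of the line and superlevel sets of maximal functions -/

section Cubes

theorem IsCube.measurableSet {Q : Set ℝ} (hQ : IsCube Q) : MeasurableSet Q := by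
  obtain ⟨a, b, hab, h1, h2⟩ := hQ
  have : Q = Ioo a b ∪ (Q ∩ {a, b}) := by
    ext x
    simp only [mem_union, mem_inter_iff, mem_insert_iff, mem_singleton_iff]
    constructor
    · intro hx
      have h := h2 hx
      rcases h.1.eq_or_lt with h3 | h3
      · exact Or.inr ⟨hx, Or.inl h3.symm⟩
      · rcases h.2.eq_or_lt with h4 | h4
        · exact Or.inr ⟨hx, Or.inr h4⟩
        · exact Or.inl ⟨h3, h4⟩
    · rintro (h | h)
      · exact h1 h
      · exact h.1
  rw [this]
  exact measurableSet_Ioo.union ((Set.toFinite _).inter_of_right _).measurableSet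

theorem isCube_Icc {a b : ℝ} (h : a < b) : IsCube (Icc a b) :=
  ⟨a, b, h, Ioo_subset_Icc_self, Subset.rfl⟩

theorem IsCube.exists_Ioo {Q : Set ℝ} (hQ : IsCube Q) (μ : Measure ℝ) [NullSingletonClass μ] :
    ∃ a b : ℝ, a < b ∧ Ioo a b ⊆ Q ∧ Q ⊆ Icc a b ∧ Ioo a b =ᵐ[μ] Q := by
  obtain ⟨a, b, hab, h1, h2⟩ := hQ
  refine ⟨a, b, hab, h1, h2, ?_⟩
  exact h1.eventuallyLE.antisymm (h2.eventuallyLE.trans Ioo_ae_eq_Icc.symm.le)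

theorem IsCube.measure_ne_top {Q : Set ℝ} (hQ : IsCube Q) (μ : Measure ℝ)
    [IsLocallyFiniteMeasure μ] : μ Q ≠ ∞ := by
  obtain ⟨a, b, hab, h1, h2⟩ := hQ
  exact ((measure_mono h2).trans_lt measure_Icc_lt_top).ne

theorem IsCube.measure_ne_zero {Q : Set ℝ} (hQ : IsCube Q) (μ : Measure ℝ)
    [μ.IsOpenPosMeasure] : μ Q ≠ 0 := by
  obtain ⟨a, b, hab, h1, h2⟩ := hQ
  intro h
  exact (isOpen_Ioo.measure_pos μ (nonempty_Ioo.2 hab)).ne' (measure_mono_null h1 h)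

theorem IsCube.le_maximalFun {Q : Set ℝ} (hQ : IsCube Q) (μ : Measure ℝ) (f : ℝ → ℂ) {x : ℝ}
    (hx : x ∈ Q) : (∫⁻ y in Q, ‖f y‖ₑ ∂μ) / μ Q ≤ maximalFun μ f x :=
  le_iSup₂_of_le (f := fun (Q : Set ℝ) (_ : IsCube Q ∧ x ∈ Q) => (∫⁻ y in Q, ‖f y‖ₑ ∂μ) / μ Q)
    Q ⟨hQ, hx⟩ le_rfl

theorem lt_maximalFun_iff {μ : Measure ℝ} {f : ℝ → ℂ} {x : ℝ} {l : ℝ≥0∞} :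
    l < maximalFun μ f x ↔
      ∃ Q, IsCube Q ∧ x ∈ Q ∧ l < (∫⁻ y in Q, ‖f y‖ₑ ∂μ) / μ Q := by
  simp only [maximalFun, lt_iSup_iff, exists_prop, and_assoc]

/-- The superlevel sets of a maximal function are open. -/
theorem isOpen_lt_maximalFun (μ : Measure ℝ) [IsLocallyFiniteMeasure μ] [NullSingletonClass μ]
    [μ.IsOpenPosMeasure] (f : ℝ → ℂ) (l : ℝ≥0∞) : IsOpen {x | l < maximalFun μ f x} := by
  rw [isOpen_iff_mem_nhds]
  intro x hx
  obtain ⟨Q, hQ, hxQ, hl⟩ := lt_maximalFun_iff.1 hx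
  obtain ⟨a, b, hab, h1, h2, h3⟩ := hQ.exists_Ioo μ
  have hQ0 := hQ.measure_ne_zero μ
  have hQt := hQ.measure_ne_top μ
  rw [ENNReal.lt_div_iff_mul_lt (Or.inl hQ0) (Or.inl hQt)] at hl
  have hIcc : μ (Icc a b) = μ Q := by
    rw [← measure_congr h3]; exact (measure_congr Ioo_ae_eq_Icc).symm
  have hlt : l ≠ ∞ := by
    rintro rfl
    rw [ENNReal.top_mul hQ0] at hl
    exact not_top_lt hl
  -- The strict inequality leaves room: for `l ≠ 0`, any cube containing `Q` of measure below `r`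
  -- still has mean above `l`. Outer regularity then lets the cube absorb a neighbourhood of `x`.
  obtain ⟨r, hr, hlr⟩ : ∃ r, μ Q < r ∧ l * r ≤ ∫⁻ y in Q, ‖f y‖ₑ ∂μ := by
    rcases eq_or_ne l 0 with rfl | hl0
    · exact ⟨∞, hQt.lt_top, by simp⟩
    · refine ⟨(∫⁻ y in Q, ‖f y‖ₑ ∂μ) / l, ?_, ?_⟩
      · rw [ENNReal.lt_div_iff_mul_lt (Or.inl hl0) (Or.inl hlt), mul_comm]
        exact hl
      · rw [ENNReal.mul_div_cancel hl0 hlt]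
  rw [← hIcc] at hr
  obtain ⟨U, hU, hUo, hUr⟩ := Set.exists_isOpen_lt_of_lt _ r hr
  obtain ⟨δ, hδ, hball⟩ := Metric.isOpen_iff.1 hUo x (hU (h2 hxQ))
  rw [Real.ball_eq_Ioo] at hball
  have hR : IsCube (Icc a b ∪ Ioo (x - δ) (x + δ)) := by
    have hxa := (h2 hxQ).1
    have hxb := (h2 hxQ).2
    refine ⟨min a (x - δ), max b (x + δ), ?_, ?_, ?_⟩
    · exact (min_le_left _ _).trans_lt (hab.trans_le (le_max_left _ _))
    · rintro z ⟨hz1, hz2⟩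
      simp only [min_lt_iff, lt_max_iff] at hz1 hz2
      simp only [mem_union, mem_Icc, mem_Ioo]
      grind
    · rintro z (⟨hz1, hz2⟩ | ⟨hz1, hz2⟩)
      · exact ⟨(min_le_left _ _).trans hz1, hz2.trans (le_max_left _ _)⟩
      · exact ⟨(min_le_right _ _).trans hz1.le, hz2.le.trans (le_max_right _ _)⟩
  filter_upwards [Ioo_mem_nhds (sub_lt_self x hδ) (lt_add_of_pos_right x hδ)] with z hz
  refine lt_of_lt_of_le ?_ (hR.le_maximalFun μ f (Or.inr hz))
  rw [ENNReal.lt_div_iff_mul_lt (Or.inl (hR.measure_ne_zero μ)) (Or.inl (hR.measure_ne_top μ))]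
  have hlt' : μ (Icc a b ∪ Ioo (x - δ) (x + δ)) < r :=
    (measure_mono (union_subset hU hball)).trans_lt hUr
  have hsub : Q ⊆ Icc a b ∪ Ioo (x - δ) (x + δ) := h2.trans subset_union_left
  rcases eq_or_ne l 0 with rfl | hl0
  · rw [zero_mul]
    exact (pos_of_gt hl).trans_le (lintegral_mono_set hsub)
  · calc l * μ (Icc a b ∪ Ioo (x - δ) (x + δ)) < l * r :=
          ENNReal.mul_lt_mul_right hl0 hlt hlt'
      _ ≤ ∫⁻ y in Q, ‖f y‖ₑ ∂μ := hlr
      _ ≤ _ := lintegral_mono_set hsub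

theorem measurable_maximalFun (μ : Measure ℝ) [IsLocallyFiniteMeasure μ] [NullSingletonClass μ]
    [μ.IsOpenPosMeasure] (f : ℝ → ℂ) : Measurable (maximalFun μ f) :=
  measurable_of_Ioi fun l => (isOpen_lt_maximalFun μ f l).measurableSet

/-- On the part of a cube where the maximal function exceeds `l`, the mean of `f` is at most `l`,
unless this part fills the interior of the cube. -/
theorem setLIntegral_lt_maximalFun_le (μ : Measure ℝ) [IsLocallyFiniteMeasure μ] [NullSingletonClass μ]
    [μ.IsOpenPosMeasure] (f : ℝ → ℂ) (l : ℝ≥0∞) {a b : ℝ}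
    (h : ¬ Ioo a b ⊆ {x | l < maximalFun μ f x}) :
    ∫⁻ y in {x | l < maximalFun μ f x} ∩ Ioo a b, ‖f y‖ₑ ∂μ ≤
      l * μ ({x | l < maximalFun μ f x} ∩ Ioo a b) := by
  set G := {x | l < maximalFun μ f x} with hG
  have hO : IsOpen (G ∩ Ioo a b) := (isOpen_lt_maximalFun μ f l).inter isOpen_Ioo
  set O := G ∩ Ioo a b with hOdef
  -- The bound is proved on each component. A component is an open interval whose closure contains a
  -- point outside `G`; that closure is a cube through this point, so its mean is at most `l`, and
  -- the endpoints carry no mass.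
  set 𝒞 : Set (Set ℝ) := connectedComponentIn O '' O with h𝒞
  have hopen : ∀ C ∈ 𝒞, IsOpen C := by
    rintro _ ⟨x, hx, rfl⟩; exact hO.connectedComponentIn
  have hdisj : 𝒞.PairwiseDisjoint id := by
    rintro _ ⟨x, hx, rfl⟩ _ ⟨y, hy, rfl⟩ hne
    rw [Function.onFun, Set.disjoint_left]
    intro z hzx hzy
    exact hne ((connectedComponentIn_eq hzx).trans (connectedComponentIn_eq hzy).symm)
  have hcount : 𝒞.Countable := by
    refine hdisj.countable_of_isOpen hopen ?_
    rintro _ ⟨x, hx, rfl⟩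
    exact ⟨x, mem_connectedComponentIn hx⟩
  have hU : O = ⋃ C ∈ 𝒞, id C := by
    ext x
    simp only [mem_iUnion, exists_prop, id]
    constructor
    · exact fun hx => ⟨_, ⟨x, hx, rfl⟩, mem_connectedComponentIn hx⟩
    · rintro ⟨_, ⟨y, hy, rfl⟩, hx⟩
      exact connectedComponentIn_subset _ _ hx
  have hmeas : ∀ C ∈ 𝒞, MeasurableSet (id C) := fun C hC => (hopen C hC).measurableSet
  conv_lhs => rw [hU]
  conv_rhs => rw [hU]
  rw [lintegral_biUnion hcount hmeas hdisj, measure_biUnion hcount hdisj hmeas, ← ENNReal.tsum_mul_left]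
  refine ENNReal.tsum_le_tsum ?_
  rintro ⟨_, x, hx, rfl⟩
  simp only [id]
  set C := connectedComponentIn O x with hC
  have hCO : C ⊆ O := connectedComponentIn_subset _ _
  have hxC : x ∈ C := mem_connectedComponentIn hx
  have hCpre : IsPreconnected C := isPreconnected_connectedComponentIn
  have hCo : IsOpen C := hO.connectedComponentIn
  have hCb : BddBelow C := ⟨a, fun z hz => (hCO hz).2.1.le⟩
  have hCa : BddAbove C := ⟨b, fun z hz => (hCO hz).2.2.le⟩
  have hCC : IsConnected C := ⟨⟨x, hxC⟩, hCpre⟩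
  have hsub1 : Ioo (sInf C) (sSup C) ⊆ C := hCC.Ioo_csInf_csSup_subset hCb hCa
  have hsub2 : C ⊆ Icc (sInf C) (sSup C) := fun z hz => ⟨csInf_le hCb hz, le_csSup hCa hz⟩
  obtain ⟨δ, hδ, hball⟩ := Metric.isOpen_iff.1 hCo x hxC
  rw [Real.ball_eq_Ioo] at hball
  have hlt : sInf C < sSup C := by
    have h1 := csInf_le hCb (hball (show x - δ / 2 ∈ _ from ⟨by linarith, by linarith⟩))
    have h2 := le_csSup hCa (hball (show x + δ / 2 ∈ _ from ⟨by linarith, by linarith⟩))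
    linarith
  -- a point of the interior of the cube outside `G` lying at the boundary of `C`
  obtain ⟨c, hcG, hcI⟩ : ∃ c, c ∉ G ∧ c ∈ Icc (sInf C) (sSup C) := by
    by_contra! hcon
    obtain ⟨w, hw, hwG⟩ := Set.not_subset.1 h
    refine hcon w hwG ?_
    have hIccG : Icc (sInf C) (sSup C) ⊆ G := fun z hz => by
      by_contra hz'; exact hcon z hz' hz
    have haI : a ≤ sInf C := le_csInf ⟨x, hxC⟩ fun z hz => (hCO hz).2.1.le
    have hbI : sSup C ≤ b := csSup_le ⟨x, hxC⟩ fun z hz => (hCO hz).2.2.le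
    -- If the closure of `C` lay in `G`, connectedness would put every point of it inside `(a, b)`
    -- into `C`. As `C` is open, it contains neither of its endpoints, so these must be `a` and `b`;
    -- but then the point `w` of `(a, b)` outside `G` is in the closure.
    have key : ∀ c ∈ Icc (sInf C) (sSup C), c ∈ Ioo a b → c ∈ C := by
      intro c hc hcab
      have hpre : IsPreconnected (Icc (sInf C) (sSup C) ∩ Ioo a b) :=
        (ordConnected_Icc.inter ordConnected_Ioo).isPreconnected
      have : Icc (sInf C) (sSup C) ∩ Ioo a b ⊆ C :=
        hpre.subset_connectedComponentIn ⟨hsub2 hxC, hx.2⟩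
          (inter_subset_inter_left _ hIccG)
      exact this ⟨hc, hcab⟩
    have hnl : sInf C ∉ C := fun hin => by
      obtain ⟨ε, hε, hb'⟩ := Metric.isOpen_iff.1 hCo _ hin
      rw [Real.ball_eq_Ioo] at hb'
      have := csInf_le hCb (hb' (show sInf C - ε / 2 ∈ _ from ⟨by linarith, by linarith⟩))
      linarith
    have hnr : sSup C ∉ C := fun hin => by
      obtain ⟨ε, hε, hb'⟩ := Metric.isOpen_iff.1 hCo _ hin
      rw [Real.ball_eq_Ioo] at hb'
      have := le_csSup hCa (hb' (show sSup C + ε / 2 ∈ _ from ⟨by linarith, by linarith⟩))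
      linarith
    have ha' : sInf C = a := by
      by_contra hne
      exact hnl (key _ ⟨le_rfl, hlt.le⟩ ⟨lt_of_le_of_ne haI (Ne.symm hne), hlt.trans_le hbI⟩)
    have hb' : sSup C = b := by
      by_contra hne
      exact hnr (key _ ⟨hlt.le, le_rfl⟩ ⟨haI.trans_lt hlt, lt_of_le_of_ne hbI hne⟩)
    rw [ha', hb']
    exact Ioo_subset_Icc_self hw
  have hcube := isCube_Icc hlt
  have hle : (∫⁻ y in Icc (sInf C) (sSup C), ‖f y‖ₑ ∂μ) / μ (Icc (sInf C) (sSup C)) ≤ l :=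
    (hcube.le_maximalFun μ f hcI).trans (not_lt.1 hcG)
  rw [ENNReal.div_le_iff (hcube.measure_ne_zero μ) (hcube.measure_ne_top μ)] at hle
  calc ∫⁻ y in C, ‖f y‖ₑ ∂μ ≤ ∫⁻ y in Icc (sInf C) (sSup C), ‖f y‖ₑ ∂μ := lintegral_mono_set hsub2
    _ ≤ l * μ (Icc (sInf C) (sSup C)) := hle
    _ = l * μ (Ioo (sInf C) (sSup C)) := by rw [measure_congr Ioo_ae_eq_Icc]
    _ ≤ l * μ C := by gcongr

end Cubes

/-! ### Indicator functions and the level sets of their maximal functions -/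

/-- The complex-valued indicator function of a set. -/
noncomputable def charFun (E : Set ℝ) : ℝ → ℂ := E.indicator fun _ => 1

theorem enorm_charFun (E : Set ℝ) (x : ℝ) : ‖charFun E x‖ₑ = E.indicator 1 x := by
  by_cases h : x ∈ E <;> simp [charFun, h]

theorem aemeasurable_charFun {E : Set ℝ} {μ : Measure ℝ} (hE : NullMeasurableSet E μ) :
    AEMeasurable (charFun E) μ :=
  aemeasurable_const.indicator₀ hE

theorem setLIntegral_enorm_charFun (μ : Measure ℝ) {E Q : Set ℝ} (hE : NullMeasurableSet E μ) :
    ∫⁻ y in Q, ‖charFun E y‖ₑ ∂μ = μ (E ∩ Q) := by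
  simp only [enorm_charFun]
  rw [lintegral_indicator_one₀ (hE.mono_ac Measure.restrict_le_self.absolutelyContinuous),
    Measure.restrict_apply₀ (hE.mono_ac Measure.restrict_le_self.absolutelyContinuous)]

theorem eLpNorm_charFun (ν : Measure ℝ) {E : Set ℝ} (hE : NullMeasurableSet E ν) {p : ℝ}
    (hp : 0 < p) : eLpNorm (charFun E) (ENNReal.ofReal p) ν = ν E ^ (1 / p) := by
  rw [charFun, eLpNorm_indicator_const₀ hE (by simpa using hp) ENNReal.ofReal_ne_top]
  simp [ENNReal.toReal_ofReal hp.le]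

theorem maximalFun_le_one (μ : Measure ℝ) {f : ℝ → ℂ} (hf : ∀ x, ‖f x‖ₑ ≤ 1) (x : ℝ) :
    maximalFun μ f x ≤ 1 := by
  refine iSup₂_le fun Q hQ => ENNReal.div_le_of_le_mul ?_
  calc ∫⁻ y in Q, ‖f y‖ₑ ∂μ ≤ ∫⁻ y in Q, 1 ∂μ := lintegral_mono fun y => hf y
    _ = 1 * μ Q := by simp

/-- The sets where the maximal function of an indicator function exceeds `2⁻ᵏ`. -/
def level (μ : Measure ℝ) (E : Set ℝ) (k : ℕ) : Set ℝ :=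
  {x | (2⁻¹ : ℝ≥0∞) ^ k < maximalFun μ (charFun E) x}

theorem level_mono (μ : Measure ℝ) (E : Set ℝ) : Monotone (level μ E) := fun _ _ hij _ hx =>
  (pow_le_pow_right_of_le_one' (ENNReal.inv_le_one.2 one_le_two) hij).trans_lt hx

/-- Almost every point of `E` is a point of density. -/
theorem measure_diff_level (μ : Measure ℝ) [IsLocallyFiniteMeasure μ] {E : Set ℝ} (hE : MeasurableSet E) {k : ℕ}
    (hk : k ≠ 0) :
    μ (E \ level μ E k) = 0 := by
  have h := Besicovitch.ae_tendsto_measure_inter_div μ E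
  rw [ae_restrict_iff' hE] at h
  refine measure_mono_null ?_ h
  rintro x ⟨hxE, hx⟩ hcon
  refine hx ?_
  -- Density one exceeds only thresholds strictly below one, whence `k ≠ 0`.
  have h1 : (2⁻¹ : ℝ≥0∞) ^ k < 1 := pow_lt_one₀ zero_le (by simp) hk
  obtain ⟨r, hr, hr0⟩ := (((hcon hxE).eventually (lt_mem_nhds h1)).and self_mem_nhdsWithin).exists
  rw [Real.closedBall_eq_Icc] at hr
  have hr0 : 0 < r := hr0
  have hcube : IsCube (Icc (x - r) (x + r)) := isCube_Icc (by linarith)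
  refine hr.trans_le ?_
  rw [← setLIntegral_enorm_charFun μ hE.nullMeasurableSet]
  exact hcube.le_maximalFun μ _ ⟨by linarith, by linarith⟩

section

variable (μ : Measure ℝ) [IsLocallyFiniteMeasure μ] [NullSingletonClass μ] [μ.IsOpenPosMeasure]

theorem measurableSet_level (E : Set ℝ) (k : ℕ) : MeasurableSet (level μ E k) :=
  (isOpen_lt_maximalFun μ _ _).measurableSet

/-- The reverse weak type inequality for the maximal function of an indicator function. -/
theorem le_measure_level_inter {E Q : Set ℝ} (hE : MeasurableSet E) (hQ : IsCube Q) {j m : ℕ}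
    (hj : j ≠ 0) (h : (2⁻¹ : ℝ≥0∞) ^ (j + m) * μ Q ≤ μ (E ∩ Q)) :
    (2⁻¹ : ℝ≥0∞) ^ m * μ Q ≤ μ (level μ E j ∩ Q) := by
  obtain ⟨a, b, hab, h1, h2, h3⟩ := hQ.exists_Ioo μ
  by_cases hsub : Ioo a b ⊆ level μ E j
  · calc (2⁻¹ : ℝ≥0∞) ^ m * μ Q ≤ 1 * μ Q := by
          gcongr; exact pow_le_one₀ zero_le (by simp)
      _ = μ (Ioo a b) := by rw [one_mul, measure_congr h3]
      _ ≤ _ := measure_mono (subset_inter hsub h1)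
  -- Otherwise the mean of `1_E` over the level set inside the cube is at most `2⁻ʲ`. Almost all of
  -- `E` lies in the level set, so `2⁻ʲ` cancels from the density assumption.
  · have hle : μ (E ∩ (level μ E j ∩ Ioo a b)) ≤ 2⁻¹ ^ j * μ (level μ E j ∩ Ioo a b) := by
      rw [← setLIntegral_enorm_charFun μ hE.nullMeasurableSet]
      exact setLIntegral_lt_maximalFun_le μ (charFun E) _ hsub
    have heq : μ (E ∩ Q) ≤ μ (E ∩ (level μ E j ∩ Ioo a b)) := by
      have : μ (E ∩ Q) = μ (E ∩ Ioo a b) := measure_congr ((ae_eq_refl E).inter h3.symm)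
      rw [this]
      calc μ (E ∩ Ioo a b) ≤ μ (E ∩ (level μ E j ∩ Ioo a b) ∪ E \ level μ E j) := by
            refine measure_mono ?_
            rintro x ⟨hx, hx'⟩
            by_cases hl : x ∈ level μ E j
            · exact Or.inl ⟨hx, hl, hx'⟩
            · exact Or.inr ⟨hx, hl⟩
        _ ≤ _ := measure_union_le _ _
        _ = _ := by rw [measure_diff_level μ hE hj, add_zero]
    have hfin : (2⁻¹ : ℝ≥0∞) ^ j * (2⁻¹ ^ m * μ Q) ≤ 2⁻¹ ^ j * μ (level μ E j ∩ Ioo a b) := by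
      rw [← mul_assoc, ← pow_add]
      exact h.trans (heq.trans hle)
    rw [ENNReal.mul_le_mul_iff_right (by simp) (by simp)] at hfin
    exact hfin.trans (measure_mono (inter_subset_inter_right _ h1))

/-- If `h` dominates a combination of the indicator functions of the level sets, its maximal
function is large on the next ones. -/
theorem sum_le_maximalFun {E : Set ℝ} (hE : MeasurableSet E) {k : ℕ} (c : ℕ → ℝ≥0∞) {h : ℝ → ℂ}
    (hc : ∀ x, ∑ j ∈ Finset.Icc 1 k, c j * (level μ E j).indicator 1 x ≤ ‖h x‖ₑ) {x : ℝ}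
    (hx : x ∈ level μ E k) :
    ∑ j ∈ Finset.Icc 1 k, c j * 2⁻¹ ^ (k - j) ≤ maximalFun μ h x := by
  -- A single cube serves all `j`: `E` has density above `2⁻ᵏ` in it, hence the level set of index
  -- `j` has density at least `2^{-(k-j)}`.
  obtain ⟨Q, hQ, hxQ, hlt⟩ := lt_maximalFun_iff.1 hx
  rw [setLIntegral_enorm_charFun μ hE.nullMeasurableSet, ENNReal.lt_div_iff_mul_lt
    (Or.inl (hQ.measure_ne_zero μ)) (Or.inl (hQ.measure_ne_top μ))] at hlt
  refine le_trans ?_ (hQ.le_maximalFun μ h hxQ)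
  rw [ENNReal.le_div_iff_mul_le (Or.inl (hQ.measure_ne_zero μ)) (Or.inl (hQ.measure_ne_top μ))]
  calc (∑ j ∈ Finset.Icc 1 k, c j * 2⁻¹ ^ (k - j)) * μ Q
      = ∑ j ∈ Finset.Icc 1 k, c j * (2⁻¹ ^ (k - j) * μ Q) := by
        rw [Finset.sum_mul]; simp only [mul_assoc]
    _ ≤ ∑ j ∈ Finset.Icc 1 k, c j * μ (level μ E j ∩ Q) := by
        refine Finset.sum_le_sum fun j hj => ?_
        rw [Finset.mem_Icc] at hj
        gcongr
        refine le_measure_level_inter μ hE hQ (by omega) ?_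
        rw [Nat.add_sub_cancel' hj.2]
        exact hlt.le
    _ = ∫⁻ y in Q, ∑ j ∈ Finset.Icc 1 k, c j * (level μ E j).indicator 1 y ∂μ := by
        rw [lintegral_finsetSum _ fun j _ =>
          (measurable_one.indicator (measurableSet_level μ E j)).const_mul _]
        refine Finset.sum_congr rfl fun j _ => ?_
        rw [lintegral_const_mul _ (measurable_one.indicator (measurableSet_level μ E j)),
          lintegral_indicator_one (measurableSet_level μ E j),
          Measure.restrict_apply (measurableSet_level μ E j)]
    _ ≤ ∫⁻ y in Q, ‖h y‖ₑ ∂μ := lintegral_mono fun y => hc y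

end

/-- Summation by parts. If `i` is the first index with `x ∈ L i`, the sum is at most `c i + ⋯ + c
k`, which telescopes to at most `a i`. This converts lower bounds on level sets into the hypothesis
of `sum_le_maximalFun`. -/
theorem sum_mul_indicator_le {L : ℕ → Set ℝ} {a c : ℕ → ℝ≥0∞} {k : ℕ} {H : ℝ → ℝ≥0∞}
    (hH : ∀ i, 1 ≤ i → ∀ x ∈ L i, a i ≤ H x)
    (hc : ∀ j, 1 ≤ j → c j + a (j + 1) = a j) (x : ℝ) :
    ∑ j ∈ Finset.Icc 1 k, c j * (L j).indicator 1 x ≤ H x := by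
  classical
  have tel : ∀ i k, 1 ≤ i → i ≤ k → ∑ j ∈ Finset.Icc i k, c j + a (k + 1) = a i := by
    intro i k hi hik
    induction k, hik using Nat.le_induction with
    | base => simpa using hc i hi
    | succ n hn ih =>
      rw [Finset.sum_Icc_succ_top (by omega), add_assoc, hc (n + 1) (by omega), ih]
  by_cases hex : ∃ i, 1 ≤ i ∧ i ≤ k ∧ x ∈ L i
  · obtain ⟨hi1, hik, hxi⟩ := Nat.find_spec hex
    set i := Nat.find hex with hi
    have hmin : ∀ j, 1 ≤ j → j < i → x ∉ L j := fun j hj hji hxj =>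
      Nat.find_min hex hji ⟨hj, by omega, hxj⟩
    calc ∑ j ∈ Finset.Icc 1 k, c j * (L j).indicator 1 x
        = ∑ j ∈ Finset.Icc i k, c j * (L j).indicator 1 x := by
          symm
          refine Finset.sum_subset (Finset.Icc_subset_Icc_left hi1) fun j hj hj' => ?_
          rw [Finset.mem_Icc] at hj hj'
          rw [indicator_of_notMem (hmin j hj.1 (by omega)), mul_zero]
      _ ≤ ∑ j ∈ Finset.Icc i k, c j := by
          refine Finset.sum_le_sum fun j _ => ?_
          calc c j * (L j).indicator 1 x ≤ c j * 1 := by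
                gcongr; exact indicator_le_self' (fun _ _ => zero_le) x
            _ = c j := mul_one _
      _ ≤ a i := by rw [← tel i k hi1 hik]; exact le_self_add
      _ ≤ H x := hH i hi1 x hxi
  · push Not at hex
    rw [Finset.sum_eq_zero]
    · exact zero_le
    · intro j hj
      rw [Finset.mem_Icc] at hj
      rw [indicator_of_notMem (hex j hj.1 hj.2), mul_zero]

/-! ### Iterated maximal functions and the gain of powers of `k` -/

/-- The complex-valued version of a function with values in `[0, ∞)`. -/
noncomputable def toComplex (h : ℝ → ℝ≥0∞) (x : ℝ) : ℂ := ((h x).toReal : ℂ)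

theorem enorm_toComplex {h : ℝ → ℝ≥0∞} {x : ℝ} (hx : h x ≤ 1) : ‖toComplex h x‖ₑ = h x := by
  rw [toComplex, ← ofReal_norm, Complex.norm_of_nonneg ENNReal.toReal_nonneg,
    ENNReal.ofReal_toReal (hx.trans_lt ENNReal.one_lt_top).ne]

theorem measurable_toComplex {h : ℝ → ℝ≥0∞} (hh : Measurable h) : Measurable (toComplex h) :=
  Complex.measurable_ofReal.comp hh.ennreal_toReal

/-- The maximal operator applied `n` times to the indicator function of a set. -/
noncomputable def iterMax (μ : Measure ℝ) (E : Set ℝ) : ℕ → ℝ → ℂ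
  | 0 => charFun E
  | n + 1 => toComplex (maximalFun μ (iterMax μ E n))

theorem enorm_iterMax_le_one (μ : Measure ℝ) (E : Set ℝ) (n : ℕ) (x : ℝ) :
    ‖iterMax μ E n x‖ₑ ≤ 1 := by
  induction n generalizing x with
  | zero =>
    rw [iterMax, enorm_charFun]
    exact indicator_le_self' (fun _ _ => zero_le) x
  | succ n ih =>
    have h := maximalFun_le_one μ ih x
    rw [iterMax, enorm_toComplex h]
    exact h

theorem enorm_iterMax_succ (μ : Measure ℝ) (E : Set ℝ) (n : ℕ) (x : ℝ) :
    ‖iterMax μ E (n + 1) x‖ₑ = maximalFun μ (iterMax μ E n) x := by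
  rw [iterMax, enorm_toComplex (maximalFun_le_one μ (enorm_iterMax_le_one μ E n) x)]

theorem le_iterMax_one (μ : Measure ℝ) (E : Set ℝ) {k : ℕ} {x : ℝ} (hx : x ∈ level μ E k) :
    2⁻¹ ^ k ≤ ‖iterMax μ E 1 x‖ₑ := by
  rw [enorm_iterMax_succ]
  exact le_of_lt hx

section

variable (μ : Measure ℝ) [IsLocallyFiniteMeasure μ] [NullSingletonClass μ] [μ.IsOpenPosMeasure]

theorem measurable_iterMax {E : Set ℝ} (hE : MeasurableSet E) (n : ℕ) :
    Measurable (iterMax μ E n) := by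
  cases n with
  | zero => exact measurable_const.indicator hE
  | succ n => exact measurable_toComplex (measurable_maximalFun μ _)

/-- Here `a j = 2⁻ʲ` has differences `2^{-(j+1)}`, and each of the `k` terms contributes the same
amount `2^{-(k+1)}`: this is the first factor `k`. -/
theorem le_iterMax_two {E : Set ℝ} (hE : MeasurableSet E) {k : ℕ} {x : ℝ}
    (hx : x ∈ level μ E k) : k * 2⁻¹ ^ (k + 1) ≤ ‖iterMax μ E 2 x‖ₑ := by
  have h2 : (2⁻¹ : ℝ≥0∞) + 2⁻¹ = 1 := ENNReal.inv_two_add_inv_two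
  rw [enorm_iterMax_succ]
  refine le_trans (le_of_eq ?_) (sum_le_maximalFun μ hE (fun j => 2⁻¹ ^ (j + 1))
    (sum_mul_indicator_le (a := fun j => 2⁻¹ ^ j) (fun i _ y hy => le_iterMax_one μ E hy) ?_) hx)
  · rw [Finset.sum_congr rfl (g := fun _ => (2⁻¹ : ℝ≥0∞) ^ (k + 1)), Finset.sum_const]
    · simp
    · intro j hj
      rw [Finset.mem_Icc] at hj
      rw [← pow_add]
      congr 1
      omega
  · intro j _
    rw [pow_succ, ← mul_add, h2, mul_one]

/-- The differences of `a j = j 2^{-(j+1)}` are `(j - 1) 2^{-(j+2)}`, and `∑ (j - 1) = k(k - 1)/2`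
gives the second factor of order `k`. -/
theorem le_iterMax_three {E : Set ℝ} (hE : MeasurableSet E) {k : ℕ} {x : ℝ}
    (hx : x ∈ level μ E k) : (k * (k - 1) : ℕ) * 2⁻¹ ^ (k + 3) ≤ ‖iterMax μ E 3 x‖ₑ := by
  have h2 : (2⁻¹ : ℝ≥0∞) + 2⁻¹ = 1 := ENNReal.inv_two_add_inv_two
  have h2' : (2 : ℝ≥0∞) * 2⁻¹ = 1 := by rw [two_mul, h2]
  rw [enorm_iterMax_succ]
  refine le_trans (le_of_eq ?_) (sum_le_maximalFun μ hE (fun j => (j - 1 : ℕ) * 2⁻¹ ^ (j + 2))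
    (sum_mul_indicator_le (a := fun j => j * 2⁻¹ ^ (j + 1))
      (fun i _ y hy => le_iterMax_two μ hE hy) ?_) hx)
  · rw [Finset.sum_congr rfl (g := fun j => ((j - 1 : ℕ) : ℝ≥0∞) * 2⁻¹ ^ (k + 2)),
      ← Finset.sum_mul, ← Nat.cast_sum]
    · have hs : (∑ j ∈ Finset.Icc 1 k, (j - 1)) * 2 = k * (k - 1) := by
        rw [← Finset.sum_range_id_mul_two, ← Finset.Ico_add_one_right_eq_Icc,
          Finset.sum_Ico_eq_sum_range]
        simp
      rw [← hs, pow_succ 2⁻¹ (k + 2)]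
      push_cast
      rw [mul_assoc, ← mul_assoc 2, mul_comm 2, mul_assoc _ 2, h2', mul_one]
    · intro j hj
      rw [Finset.mem_Icc] at hj
      rw [mul_assoc, ← pow_add]
      congr 2
      omega
  · intro j hj
    rw [show j + 1 + 1 = j + 2 from rfl, ← add_mul, ← Nat.cast_add,
      show j - 1 + (j + 1) = j * 2 by omega, show j + 2 = (j + 1) + 1 from rfl, pow_succ _ (j + 1)]
    push_cast
    rw [mul_assoc, mul_comm _ (2⁻¹ : ℝ≥0∞), ← mul_assoc 2, h2', one_mul]

end

/-! ### Dyadic decompositions and the duality of Lorentz spaces -/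

theorem maximalFun_charFun_le_tsum (μ : Measure ℝ) (E : Set ℝ) (x : ℝ) :
    maximalFun μ (charFun E) x ≤ ∑' n : ℕ, 2⁻¹ ^ n * (level μ E (n + 2)).indicator 1 x := by
  classical
  rcases eq_or_ne (maximalFun μ (charFun E) x) 0 with h0 | h0
  · rw [h0]; exact zero_le
  have hex : ∃ n : ℕ, (2⁻¹ : ℝ≥0∞) ^ (n + 1) < maximalFun μ (charFun E) x := by
    have h := ENNReal.tendsto_pow_atTop_nhds_zero_of_lt_one (r := 2⁻¹) (by simp)
    obtain ⟨n, hn⟩ := ((h.comp (tendsto_add_atTop_nat 1)).eventually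
      (gt_mem_nhds (pos_iff_ne_zero.2 h0))).exists
    exact ⟨n, hn⟩
  have hn := Nat.find_spec hex
  set n := Nat.find hex with hndef
  have hle : maximalFun μ (charFun E) x ≤ 2⁻¹ ^ n := by
    rcases Nat.eq_zero_or_pos n with h | h
    · rw [h, pow_zero]
      exact maximalFun_le_one μ (fun y => enorm_iterMax_le_one μ E 0 y) x
    · have := Nat.find_min hex (m := n - 1) (by omega)
      rwa [Nat.sub_add_cancel h, not_lt] at this
  -- The index `n + 1` is weakened to `k = n + 2` so that `k(k - 1)` in `le_iterMax_three` never
  -- vanishes.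
  have hmem : x ∈ level μ E (n + 2) := level_mono μ E (Nat.le_succ _) hn
  refine le_trans ?_ (ENNReal.le_tsum n)
  rw [indicator_of_mem hmem, Pi.one_apply, mul_one]
  exact hle

/-- Above height `t`, the dyadic layer containing `g` alone already dominates it. -/
theorem le_add_tsum_indicator {t g : ℝ≥0∞} (ht : t ≠ 0) (hg : g ≠ ∞) :
    g ≤ t + ∑' i : ℕ, 2 ^ (i + 1) * t * (Iio g).indicator 1 (2 ^ i * t) := by
  classical
  rcases le_or_gt g t with h | h
  · exact h.trans le_self_add
  have htt : t ≠ ∞ := (h.trans_le le_top).ne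
  have hex : ∃ i : ℕ, g ≤ 2 ^ (i + 1) * t := by
    obtain ⟨n, hn⟩ := ENNReal.exists_nat_gt (ENNReal.div_ne_top hg ht)
    refine ⟨n, ?_⟩
    rw [ENNReal.div_lt_iff (Or.inl ht) (Or.inl htt)] at hn
    refine hn.le.trans ?_
    gcongr
    calc (n : ℝ≥0∞) ≤ ((2 ^ (n + 1) : ℕ) : ℝ≥0∞) := by
          exact_mod_cast (Nat.lt_two_pow_self.trans (Nat.pow_lt_pow_succ (by norm_num))).le
      _ = _ := by push_cast; rfl
  have hi := Nat.find_spec hex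
  set i := Nat.find hex with hidef
  have hlt : 2 ^ i * t < g := by
    rcases Nat.eq_zero_or_pos i with h' | h'
    · rwa [h', pow_zero, one_mul]
    · have := Nat.find_min hex (m := i - 1) (by omega)
      rwa [Nat.sub_add_cancel h', not_le] at this
  refine le_trans ?_ (le_add_left (ENNReal.le_tsum i))
  rw [indicator_of_mem (show 2 ^ i * t ∈ Iio g from hlt), Pi.one_apply, mul_one]
  exact hi

theorem rpow_one_div_mul_rpow_one_div {p q : ℝ} (hpq : p.HolderConjugate q) (a : ℝ≥0∞) :
    a ^ (1 / p) * a ^ (1 / q) = a := by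
  rw [← ENNReal.rpow_add_of_nonneg _ _ (one_div_nonneg.2 hpq.nonneg)
    (one_div_nonneg.2 hpq.symm.nonneg), one_div, one_div, hpq.inv_add_inv_eq_one, ENNReal.rpow_one]

/-- The duality of `L^{q,∞}` with indicator functions in `L^{p,1}`. -/
theorem exists_setLIntegral_le_of_weak {p q : ℝ} (hpq : p.HolderConjugate q) :
    ∃ K : ℝ≥0, ∀ (ν : Measure ℝ) (G : ℝ → ℝ≥0∞) (B : ℝ≥0∞), Measurable G → (∀ x, G x ≠ ∞) →
      (∀ y : ℝ≥0, 0 < y → y * ν {x | y < G x} ^ (1 / q) ≤ B) →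
      ∀ A : Set ℝ, ν A ≠ ∞ → ∫⁻ x in A, G x ∂ν ≤ K * B * ν A ^ (1 / p) := by
  have hq1 : 1 < q := hpq.symm.lt
  have hq0 : 0 < q := by linarith
  -- Doubling the height divides the weak type bound on the measure by `2^q`; since `q > 1`, the
  -- layers sum as a geometric series.
  have hr : (2 : ℝ≥0∞) * (2 : ℝ≥0∞)⁻¹ ^ q < 1 := by
    have h1 : (2 : ℝ≥0∞)⁻¹ ^ q < 2⁻¹ := by
      conv_rhs => rw [← ENNReal.rpow_one 2⁻¹]
      exact ENNReal.rpow_lt_rpow_of_exponent_gt (by simp) (by simp) hq1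
    calc (2 : ℝ≥0∞) * (2 : ℝ≥0∞)⁻¹ ^ q < 2 * 2⁻¹ :=
          ENNReal.mul_lt_mul_right (by simp) (by simp) h1
      _ = 1 := ENNReal.mul_inv_cancel (by simp) (by simp)
  set r := (2 : ℝ≥0∞) * (2 : ℝ≥0∞)⁻¹ ^ q with hrdef
  have hK : 1 + 2 * ∑' i : ℕ, r ^ i ≠ ∞ := by
    rw [ENNReal.tsum_geometric]
    refine ENNReal.add_ne_top.2 ⟨by simp, ENNReal.mul_ne_top (by simp) ?_⟩
    exact ENNReal.inv_ne_top.2 (tsub_pos_of_lt hr).ne'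
  refine ⟨(1 + 2 * ∑' i : ℕ, r ^ i).toNNReal, fun ν G B hG hGt hweak A hA => ?_⟩
  rw [ENNReal.coe_toNNReal hK]
  rcases eq_or_ne (ν A) 0 with hA0 | hA0
  · rw [setLIntegral_measure_zero _ _ hA0]; exact zero_le
  have hAp0 : ∀ s : ℝ, ν A ^ s ≠ 0 := fun s => (ENNReal.rpow_pos (pos_iff_ne_zero.2 hA0) hA).ne'
  have hApt : ∀ s : ℝ, ν A ^ s ≠ ∞ := fun s => ENNReal.rpow_ne_top_of_ne_zero hA0 hA
  rcases eq_or_ne B ∞ with hBt | hBt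
  · rw [hBt, ENNReal.mul_top (by simp), ENNReal.top_mul (hAp0 _)]
    exact le_top
  rcases eq_or_ne B 0 with hB0 | hB0
  · have hnull : ∀ n : ℕ, ∀ᵐ x ∂ν, G x ≤ ((n : ℝ≥0∞) + 1)⁻¹ := by
      intro n
      have h := hweak ((n : ℝ≥0) + 1)⁻¹ (by positivity)
      rw [hB0, nonpos_iff_eq_zero, mul_eq_zero] at h
      rcases h with h | h
      · simp at h
      · rw [ENNReal.rpow_eq_zero_iff_of_pos (by positivity)] at h
        rw [ae_iff]
        refine measure_mono_null (fun x hx => ?_) h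
        have hx' : ((n : ℝ≥0∞) + 1)⁻¹ < G x := not_le.1 hx
        have e : ((((n : ℝ≥0) + 1)⁻¹ : ℝ≥0) : ℝ≥0∞) = ((n : ℝ≥0∞) + 1)⁻¹ := by
          rw [ENNReal.coe_inv (by positivity)]
          simp
        rw [mem_ofPred_eq, e]
        exact hx'
    have hG0 : ∀ᵐ x ∂ν, G x = 0 := by
      filter_upwards [ae_all_iff.2 hnull] with x hx
      by_contra hne
      obtain ⟨n, hn⟩ := ENNReal.exists_inv_nat_lt hne
      refine absurd (hx n) (not_le.2 (lt_of_le_of_lt ?_ hn))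
      exact ENNReal.inv_le_inv.2 le_self_add
    rw [lintegral_congr_ae (ae_restrict_of_ae hG0)]
    simp
  -- The height at which the trivial bound `ν A` equals the weak type bound `(B / t)^q`.
  set t := B / ν A ^ (1 / q) with htdef
  have ht0 : t ≠ 0 := (ENNReal.div_pos hB0 (hApt _)).ne'
  have htt : t ≠ ∞ := ENNReal.div_ne_top hBt (hAp0 _)
  have htA : t * ν A = B * ν A ^ (1 / p) := by
    conv_lhs => rw [← rpow_one_div_mul_rpow_one_div hpq (ν A), mul_comm (ν A ^ (1 / p)),
      ← mul_assoc, htdef, ENNReal.div_mul_cancel (hAp0 _) (hApt _)]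
  have hlev : ∀ i : ℕ, ν {x | 2 ^ i * t < G x} ≤ ν A * ((2 : ℝ≥0∞)⁻¹ ^ q) ^ i := by
    intro i
    have hyt : 2 ^ i * t ≠ ∞ := ENNReal.mul_ne_top (by simp) htt
    have hy0 : 2 ^ i * t ≠ 0 := mul_ne_zero (by simp) ht0
    have h := hweak (2 ^ i * t).toNNReal (ENNReal.toNNReal_pos hy0 hyt)
    rw [ENNReal.coe_toNNReal hyt, mul_comm, ← ENNReal.le_div_iff_mul_le (Or.inl hy0) (Or.inl hyt),
      one_div, ENNReal.rpow_inv_le_iff hq0] at h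
    refine h.trans (le_of_eq ?_)
    have : B / (2 ^ i * t) = ν A ^ (1 / q) * 2⁻¹ ^ i := by
      have hB : B = t * ν A ^ (1 / q) := by
        rw [htdef, ENNReal.div_mul_cancel (hAp0 _) (hApt _)]
      rw [hB, mul_comm _ t, ENNReal.mul_div_mul_left _ _ ht0 htt, div_eq_mul_inv, ENNReal.inv_pow]
    rw [this, ENNReal.mul_rpow_of_nonneg _ _ hq0.le, ← ENNReal.rpow_mul, one_div,
      inv_mul_cancel₀ hq0.ne', ENNReal.rpow_one, ← ENNReal.rpow_natCast, ← ENNReal.rpow_natCast,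
      ← ENNReal.rpow_mul, ← ENNReal.rpow_mul, mul_comm q]
  have hms : ∀ i : ℕ, MeasurableSet {x | 2 ^ i * t < G x} := fun i => hG measurableSet_Ioi
  calc ∫⁻ x in A, G x ∂ν
      ≤ ∫⁻ x in A, (t + ∑' i : ℕ, 2 ^ (i + 1) * t * {x | 2 ^ i * t < G x}.indicator 1 x) ∂ν :=
        lintegral_mono fun x => le_add_tsum_indicator ht0 (hGt x)
    _ = t * ν A + ∑' i : ℕ, 2 ^ (i + 1) * t * ν ({x | 2 ^ i * t < G x} ∩ A) := by
        rw [lintegral_add_left measurable_const, lintegral_const, Measure.restrict_apply_univ,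
          lintegral_tsum fun i => ((measurable_one.indicator (hms i)).const_mul _).aemeasurable]
        congr 1
        refine tsum_congr fun i => ?_
        rw [lintegral_const_mul _ (measurable_one.indicator (hms i)),
          lintegral_indicator_one (hms i), Measure.restrict_apply (hms i)]
    _ ≤ t * ν A + ∑' i : ℕ, 2 ^ (i + 1) * t * (ν A * ((2 : ℝ≥0∞)⁻¹ ^ q) ^ i) := by
        gcongr with i
        exact (measure_mono inter_subset_left).trans (hlev i)
    _ = (1 + 2 * ∑' i : ℕ, r ^ i) * (t * ν A) := by
        rw [add_mul, one_mul, mul_assoc, ← ENNReal.tsum_mul_right, ← ENNReal.tsum_mul_left]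
        congr 1
        refine tsum_congr fun i => ?_
        rw [hrdef, mul_pow, pow_succ]
        ring
    _ = (1 + 2 * ∑' i : ℕ, r ^ i) * B * ν A ^ (1 / p) := by rw [htA, mul_assoc]

theorem lorentzOne_charFun_le (F : Set ℝ) {q : ℝ} (hq : 0 < q) (ν : Measure ℝ) :
    lorentzOne (charFun F) q ν ≤ ν F ^ (1 / q) := by
  calc lorentzOne (charFun F) q ν
      ≤ ∫⁻ y in Ioi (0 : ℝ), (Iio (1 : ℝ)).indicator (fun _ => ν F ^ (1 / q)) y := by
        refine setLIntegral_mono (measurable_const.indicator measurableSet_Iio) fun y hy => ?_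
        by_cases h : y < 1
        · rw [indicator_of_mem (show y ∈ Iio 1 from h)]
          gcongr
          refine measure_mono fun x hx => ?_
          by_contra hxF
          simp [enorm_charFun, indicator_of_notMem hxF] at hx
        · rw [indicator_of_notMem (show y ∉ Iio 1 from h)]
          have : distrib (charFun F) ν y.toNNReal = 0 := by
            have hempty : {x | (y.toNNReal : ℝ≥0∞) < ‖charFun F x‖ₑ} = ∅ := by
              refine eq_empty_of_forall_notMem fun x hx => ?_
              have h1 : ‖charFun F x‖ₑ ≤ 1 := by
                rw [enorm_charFun]; exact indicator_le_self' (fun _ _ => zero_le) x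
              have h2 : (1 : ℝ≥0∞) ≤ (y.toNNReal : ℝ≥0∞) := by
                have : (1 : ℝ≥0) ≤ y.toNNReal := by
                  rw [Real.one_le_toNNReal]; exact not_lt.1 h
                exact_mod_cast this
              exact absurd (h2.trans_lt hx) (not_lt.2 h1)
            rw [distrib, hempty, measure_empty]
          rw [this, ENNReal.zero_rpow_of_pos (by positivity)]
    _ = ν F ^ (1 / q) := by
        rw [lintegral_indicator measurableSet_Iio, lintegral_const,
          Measure.restrict_apply_univ, Measure.restrict_apply measurableSet_Iio, inter_comm,
          Ioi_inter_Iio, Real.volume_Ioo]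
        simp

/-! ### Integrating a product of maximal functions of indicators -/

theorem eLpNorm_iterMax_le {μ ν : Measure ℝ} [IsLocallyFiniteMeasure μ] [NullSingletonClass μ]
    [μ.IsOpenPosMeasure] {p : ℝ} (hp : 0 < p) {C : ℝ≥0}
    (hC : ∀ f : ℝ → ℂ, AEMeasurable f volume → eLpNorm f (ENNReal.ofReal p) ν < ∞ →
      eLpNorm (maximalFun μ f) (ENNReal.ofReal p) ν ≤ C * eLpNorm f (ENNReal.ofReal p) ν)
    {E : Set ℝ} (hE : MeasurableSet E) (hEν : ν E ≠ ∞) (n : ℕ) :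
    eLpNorm (iterMax μ E n) (ENNReal.ofReal p) ν ≤ C ^ n * ν E ^ (1 / p) := by
  induction n with
  | zero => rw [iterMax, eLpNorm_charFun ν hE.nullMeasurableSet hp, pow_zero, one_mul]
  | succ n ih =>
    have hlt : eLpNorm (iterMax μ E n) (ENNReal.ofReal p) ν < ∞ :=
      ih.trans_lt (ENNReal.mul_lt_top (by simp)
        (ENNReal.rpow_lt_top_of_nonneg (by positivity) hEν))
    calc eLpNorm (iterMax μ E (n + 1)) (ENNReal.ofReal p) ν
        = eLpNorm (maximalFun μ (iterMax μ E n)) (ENNReal.ofReal p) ν :=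
          eLpNorm_congr_enorm_ae (Eventually.of_forall fun x => by
            rw [enorm_iterMax_succ, enorm_eq_self])
      _ ≤ C * (C ^ n * ν E ^ (1 / p)) :=
          (hC _ (measurable_iterMax μ hE n).aemeasurable hlt).trans (by gcongr)
      _ = C ^ (n + 1) * ν E ^ (1 / p) := by rw [pow_succ']; ring

/-- Chebyshev's inequality for the third iterate, which on this level set is at least `(n + 2)(n +
1) 2^{-(n+5)}`. The constant `32` is `2⁵`, and the quadratic decay makes the bounds summable in `n`.
-/
theorem measure_level_le {μ ν : Measure ℝ} [IsLocallyFiniteMeasure μ] [NullSingletonClass μ]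
    [μ.IsOpenPosMeasure] {p : ℝ} (hp : 0 < p) {C : ℝ≥0}
    (hC : ∀ f : ℝ → ℂ, AEMeasurable f volume → eLpNorm f (ENNReal.ofReal p) ν < ∞ →
      eLpNorm (maximalFun μ f) (ENNReal.ofReal p) ν ≤ C * eLpNorm f (ENNReal.ofReal p) ν)
    {E : Set ℝ} (hE : MeasurableSet E) (hEν : ν E ≠ ∞) (n : ℕ) :
    2⁻¹ ^ n * ν (level μ E (n + 2)) ^ (1 / p) ≤
      32 * C ^ 3 * ν E ^ (1 / p) * (((n + 1) * (n + 2) : ℕ) : ℝ≥0∞)⁻¹ := by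
  set ε : ℝ≥0∞ := (((n + 2) * (n + 2 - 1) : ℕ) : ℝ≥0∞) * 2⁻¹ ^ (n + 2 + 3) with hε
  have h1 := mul_meas_ge_le_pow_eLpNorm' ν (p := ENNReal.ofReal p) (by simpa using hp)
    ENNReal.ofReal_ne_top (measurable_iterMax μ hE 3).aestronglyMeasurable ε
  rw [ENNReal.toReal_ofReal hp.le] at h1
  have h2 : ε ^ p * ν (level μ E (n + 2)) ≤ (C ^ 3 * ν E ^ (1 / p)) ^ p := by
    refine le_trans ?_ (h1.trans ?_)
    · gcongr
      exact fun x hx => le_iterMax_three μ hE hx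
    · gcongr
      exact eLpNorm_iterMax_le hp hC hE hEν 3
  have h3 : ε * ν (level μ E (n + 2)) ^ (1 / p) ≤ C ^ 3 * ν E ^ (1 / p) := by
    have h := ENNReal.rpow_le_rpow h2 (z := 1 / p) (by positivity)
    rwa [ENNReal.mul_rpow_of_nonneg _ _ (by positivity), ← ENNReal.rpow_mul, ← ENNReal.rpow_mul,
      mul_one_div_cancel hp.ne', ENNReal.rpow_one, ENNReal.rpow_one] at h
  have hN0 : (((n + 1) * (n + 2) : ℕ) : ℝ≥0∞) ≠ 0 := by
    exact_mod_cast (Nat.mul_pos (Nat.succ_pos n) (Nat.succ_pos (n + 1))).ne'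
  rw [← div_eq_mul_inv, ENNReal.le_div_iff_mul_le (Or.inl hN0) (Or.inl (ENNReal.natCast_ne_top _))]
  calc 2⁻¹ ^ n * ν (level μ E (n + 2)) ^ (1 / p) * (((n + 1) * (n + 2) : ℕ) : ℝ≥0∞)
      = 32 * (ε * ν (level μ E (n + 2)) ^ (1 / p)) := by
        have h32 : (32 : ℝ≥0∞) * 2⁻¹ ^ 5 = 1 := by
          rw [ENNReal.inv_pow.symm]
          norm_num
          exact ENNReal.mul_inv_cancel (by simp) (by simp)
        rw [hε, show (n + 2) * (n + 2 - 1) = (n + 1) * (n + 2) by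
          rw [Nat.add_sub_assoc (by norm_num), mul_comm], show n + 2 + 3 = n + 5 from rfl, pow_add]
        generalize (((n + 1) * (n + 2) : ℕ) : ℝ≥0∞) = N
        generalize ν (level μ E (n + 2)) ^ (1 / p) = X
        calc 2⁻¹ ^ n * X * N = (32 * 2⁻¹ ^ 5) * (2⁻¹ ^ n * X * N) := by rw [h32, one_mul]
          _ = 32 * (N * (2⁻¹ ^ n * 2⁻¹ ^ 5) * X) := by ring
    _ ≤ 32 * (C ^ 3 * ν E ^ (1 / p)) := by gcongr
    _ = 32 * C ^ 3 * ν E ^ (1 / p) := by ring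

theorem tsum_inv_mul_succ_ne_top :
    ∑' n : ℕ, (((n + 1) * (n + 2) : ℕ) : ℝ≥0∞)⁻¹ ≠ ∞ := by
  have hs : Summable fun n : ℕ => (((n + 1 : ℕ) : ℝ≥0) ^ 2)⁻¹ :=
    NNReal.summable_nat_add (fun n : ℕ => ((n : ℝ≥0) ^ 2)⁻¹)
      (NNReal.summable_coe.1 (by simp)) 1
  refine ne_top_of_le_ne_top (ENNReal.tsum_coe_ne_top_iff_summable.2 hs) ?_
  refine ENNReal.tsum_le_tsum fun n => ?_
  rw [ENNReal.coe_inv (by positivity)]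
  refine ENNReal.inv_le_inv.2 ?_
  have : (n + 1) ^ 2 ≤ (n + 1) * (n + 2) := by rw [pow_two]; gcongr; omega
  exact_mod_cast this

/-- A strong type bound for one maximal operator and a restricted weak type bound for another, for
conjugate exponents, control the integral of the product of maximal functions of indicators. -/
theorem exists_lintegral_maximalFun_mul_le {μ τ ν : Measure ℝ}
    [IsLocallyFiniteMeasure μ] [NullSingletonClass μ] [μ.IsOpenPosMeasure]
    [IsLocallyFiniteMeasure τ] [NullSingletonClass τ] [τ.IsOpenPosMeasure]
    {p q : ℝ} (hpq : p.HolderConjugate q)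
    (hμ : MaximalStrong μ p ν) (hτ : MaximalRestricted τ q ν) :
    ∃ C : ℝ≥0, ∀ E F : Set ℝ, MeasurableSet E → MeasurableSet F → ν E ≠ ∞ → ν F ≠ ∞ →
      ∫⁻ x, maximalFun μ (charFun E) x * maximalFun τ (charFun F) x ∂ν ≤
        C * (ν E ^ (1 / p) * ν F ^ (1 / q)) := by
  obtain ⟨C₁, hC₁⟩ := hμ
  obtain ⟨C₂, hC₂⟩ := hτ
  obtain ⟨K, hK⟩ := exists_setLIntegral_le_of_weak hpq
  have hp : 0 < p := hpq.pos
  have hq : 0 < q := hpq.symm.pos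
  set S := ∑' n : ℕ, (((n + 1) * (n + 2) : ℕ) : ℝ≥0∞)⁻¹ with hS
  have hSt : S ≠ ∞ := tsum_inv_mul_succ_ne_top
  refine ⟨K * C₂ * (32 * C₁ ^ 3 * S.toNNReal), fun E F hE hF hEν hFν => ?_⟩
  set G := maximalFun τ (charFun F) with hGdef
  have hG : Measurable G := measurable_maximalFun τ _
  have hGt : ∀ x, G x ≠ ∞ := fun x =>
    ((maximalFun_le_one τ (fun y => enorm_iterMax_le_one τ F 0 y) x).trans_lt
      ENNReal.one_lt_top).ne
  have hweak : ∀ y : ℝ≥0, 0 < y → y * ν {x | y < G x} ^ (1 / q) ≤ C₂ * ν F ^ (1 / q) := by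
    intro y hy
    have hlor := lorentzOne_charFun_le F hq ν
    have hmem : MemLorentzOne (charFun F) q ν :=
      ⟨aemeasurable_charFun hF.nullMeasurableSet, hlor.trans_lt
        (ENNReal.rpow_lt_top_of_nonneg (by positivity) hFν)⟩
    refine le_trans ?_ ((hC₂ _ hmem).trans (by gcongr))
    have := le_iSup₂_of_le (f := fun (y : ℝ≥0) (_ : 0 < y) =>
      (y : ℝ≥0∞) * (distrib (maximalFun τ (charFun F)) ν y) ^ (1 / q)) y hy le_rfl
    rw [distrib] at this
    simp only [enorm_eq_self] at this
    exact this
  have hlev := measure_level_le hp hC₁ hE hEν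
  have hlevt : ∀ n, ν (level μ E (n + 2)) ≠ ∞ := by
    intro n h
    have h' := hlev n
    rw [h, ENNReal.top_rpow_of_pos (by positivity), ENNReal.mul_top (by simp), top_le_iff] at h'
    refine ENNReal.mul_ne_top (ENNReal.mul_ne_top (ENNReal.mul_ne_top (by simp) (by simp))
      (ENNReal.rpow_ne_top_of_nonneg (by positivity) hEν)) ?_ h'
    simp
  -- Only the factor with the strong bound is cut into level sets; the other is integrated over each
  -- of them by weak type duality.
  calc ∫⁻ x, maximalFun μ (charFun E) x * G x ∂ν
      ≤ ∫⁻ x, ∑' n : ℕ, 2⁻¹ ^ n * (level μ E (n + 2)).indicator G x ∂ν := by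
        refine lintegral_mono fun x => ?_
        calc maximalFun μ (charFun E) x * G x
            ≤ (∑' n : ℕ, 2⁻¹ ^ n * (level μ E (n + 2)).indicator 1 x) * G x := by
              gcongr; exact maximalFun_charFun_le_tsum μ E x
          _ = _ := by
              rw [← ENNReal.tsum_mul_right]
              refine tsum_congr fun n => ?_
              by_cases hx : x ∈ level μ E (n + 2) <;> simp [hx]
    _ = ∑' n : ℕ, 2⁻¹ ^ n * ∫⁻ x in level μ E (n + 2), G x ∂ν := by
        have hm : ∀ n, Measurable ((level μ E (n + 2)).indicator G) := fun n =>
          hG.indicator (measurableSet_level μ E _)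
        rw [lintegral_tsum fun n => ((hm n).const_mul _).aemeasurable]
        refine tsum_congr fun n => ?_
        rw [lintegral_const_mul _ (hm n), lintegral_indicator (measurableSet_level μ E _)]
    _ ≤ ∑' n : ℕ, K * (C₂ * ν F ^ (1 / q)) * (32 * C₁ ^ 3 * ν E ^ (1 / p)) *
          (((n + 1) * (n + 2) : ℕ) : ℝ≥0∞)⁻¹ := by
        refine ENNReal.tsum_le_tsum fun n => ?_
        calc 2⁻¹ ^ n * ∫⁻ x in level μ E (n + 2), G x ∂ν
            ≤ 2⁻¹ ^ n * (K * (C₂ * ν F ^ (1 / q)) * ν (level μ E (n + 2)) ^ (1 / p)) := by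
              gcongr
              exact hK ν G _ hG hGt hweak _ (hlevt n)
          _ = K * (C₂ * ν F ^ (1 / q)) * (2⁻¹ ^ n * ν (level μ E (n + 2)) ^ (1 / p)) := by ring
          _ ≤ K * (C₂ * ν F ^ (1 / q)) * (32 * C₁ ^ 3 * ν E ^ (1 / p) *
                (((n + 1) * (n + 2) : ℕ) : ℝ≥0∞)⁻¹) := mul_le_mul' le_rfl (hlev n)
          _ = _ := by ring
    _ = _ := by
        rw [ENNReal.tsum_mul_left, ← hS]
        push_cast
        rw [ENNReal.coe_toNNReal hSt]
        ring

/-! ### Weights, their measures and the `A_∞` comparison -/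

namespace IsWeight

variable {w : ℝ → ℝ}

theorem aemeasurable (hw : IsWeight w) : AEMeasurable w volume :=
  hw.1.aestronglyMeasurable.aemeasurable

theorem wMeasure_ac (w : ℝ → ℝ) : wMeasure w ≪ volume := withDensity_absolutelyContinuous _ _

theorem ac_wMeasure (hw : IsWeight w) : volume ≪ wMeasure w := by
  refine withDensity_absolutelyContinuous' hw.aemeasurable.ennreal_ofReal ?_
  filter_upwards [hw.2] with x hx
  simpa using hx

theorem isLocallyFiniteMeasure (hw : IsWeight w) : IsLocallyFiniteMeasure (wMeasure w) := by
  refine ⟨fun x => ?_⟩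
  obtain ⟨U, hU, hint⟩ := hw.1 x
  refine ⟨U, hU, ?_⟩
  rw [wMeasure, withDensity_apply' _ U]
  refine lt_of_le_of_lt (lintegral_mono fun y => ?_) hint.2
  exact Real.ofReal_le_enorm (w y)

theorem nullSingletonClass (w : ℝ → ℝ) : NullSingletonClass (wMeasure w) :=
  ⟨fun x => wMeasure_ac w (measure_singleton x)⟩

theorem isOpenPosMeasure (hw : IsWeight w) : (wMeasure w).IsOpenPosMeasure :=
  hw.ac_wMeasure.isOpenPosMeasure

theorem lintegral_wMeasure (hw : IsWeight w) {h : ℝ → ℝ≥0∞} (hh : AEMeasurable h volume) {A : Set ℝ}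
    (hA : NullMeasurableSet A volume) :
    ∫⁻ x in A, h x ∂(wMeasure w) = ∫⁻ x in A, ENNReal.ofReal (w x) * h x := by
  rw [← lintegral_indicator₀ (hA.mono_ac (wMeasure_ac w)), wMeasure,
    lintegral_withDensity_eq_lintegral_mul₀ hw.aemeasurable.ennreal_ofReal (hh.indicator₀ hA),
    ← lintegral_indicator₀ hA]
  refine lintegral_congr fun x => ?_
  by_cases hx : x ∈ A <;> simp [hx]

end IsWeight

/-- Sets occupying a fixed proportion of a cube have comparable `v`-measure. -/
theorem MemAInfty.exists_measure_le {v : ℝ → ℝ} (hv : MemAInfty v) {η : ℝ} (hη : 0 < η) :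
    ∃ C : ℝ≥0, ∀ Q E : Set ℝ, IsCube Q → E ⊆ Q → NullMeasurableSet E volume →
      ENNReal.ofReal η * volume Q ≤ volume E → wMeasure v Q ≤ C * wMeasure v E := by
  have hη0 : ENNReal.ofReal η ≠ 0 := by simpa using hη
  -- The average over `Q` itself shows that the maximal function of `1_E` is at least `η` throughout
  -- `Q`, so the `A_q` bound need only be tested on `1_E`.
  have hM : ∀ Q E : Set ℝ, IsCube Q → E ⊆ Q → NullMeasurableSet E volume →
      ENNReal.ofReal η * volume Q ≤ volume E →
      Q ⊆ {x | ENNReal.ofReal η ≤ maximalFun volume (charFun E) x} := by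
    intro Q E hQ hEQ hE hle x hx
    refine le_trans ?_ (hQ.le_maximalFun volume _ hx)
    rw [setLIntegral_enorm_charFun _ hE, inter_eq_left.2 hEQ, ENNReal.le_div_iff_mul_le
      (Or.inl (hQ.measure_ne_zero _)) (Or.inl (hQ.measure_ne_top _))]
    exact hle
  have hw : IsWeight v := by
    rcases hv with h | ⟨_, _, h⟩
    exacts [h.1, h.1]
  have := hw.isLocallyFiniteMeasure
  have hnt : ∀ Q E : Set ℝ, IsCube Q → E ⊆ Q → wMeasure v E ≠ ∞ := fun Q E hQ hEQ =>
    ne_top_of_le_ne_top (hQ.measure_ne_top _) (measure_mono hEQ)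
  rcases hv with ⟨-, C, hC⟩ | ⟨q, hq, -, C, hC⟩
  -- The weak norm sees strict superlevel sets, hence `η / 2`; Chebyshev's inequality in the other
  -- case allows `η` itself.
  · refine ⟨(ENNReal.ofReal (η / 2))⁻¹.toNNReal * C, fun Q E hQ hEQ hE hle => ?_⟩
    have hEν := hE.mono_ac (IsWeight.wMeasure_ac v)
    have hη2 : ENNReal.ofReal (η / 2) ≠ 0 := by simpa using hη
    have hnorm := eLpNorm_charFun (wMeasure v) hEν one_pos
    have hfin : eLpNorm (charFun E) (ENNReal.ofReal 1) (wMeasure v) < ∞ := by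
      rw [hnorm, div_one, ENNReal.rpow_one]
      exact (hnt Q E hQ hEQ).lt_top
    have h := hC _ (aemeasurable_charFun hE) hfin
    rw [hnorm, div_one, ENNReal.rpow_one] at h
    have h2 := (le_iSup₂_of_le (f := fun (y : ℝ≥0) (_ : 0 < y) =>
      (y : ℝ≥0∞) * (distrib (maximalFun volume (charFun E)) (wMeasure v) y) ^ ((1 : ℝ) / 1))
      (η / 2).toNNReal (Real.toNNReal_pos.2 (by positivity)) le_rfl).trans h
    rw [div_one, ENNReal.rpow_one, distrib] at h2
    push_cast
    rw [ENNReal.coe_toNNReal (ENNReal.inv_ne_top.2 hη2), mul_assoc, mul_comm,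
      ← div_eq_mul_inv, ENNReal.le_div_iff_mul_le (Or.inl hη2) (Or.inl ENNReal.ofReal_ne_top),
      mul_comm]
    refine le_trans ?_ h2
    refine mul_le_mul' le_rfl (measure_mono fun x hx => ?_)
    rw [mem_ofPred_eq, enorm_eq_self]
    refine lt_of_lt_of_le ?_ (hM Q E hQ hEQ hE hle hx)
    exact (ENNReal.ofReal_lt_ofReal_iff hη).2 (by linarith)
  · have hq0 : 0 < q := by linarith
    refine ⟨((ENNReal.ofReal η) ^ q)⁻¹.toNNReal * C ^ q, fun Q E hQ hEQ hE hle => ?_⟩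
    have hEν := hE.mono_ac (IsWeight.wMeasure_ac v)
    have hnorm := eLpNorm_charFun (wMeasure v) hEν hq0
    have hfin : eLpNorm (charFun E) (ENNReal.ofReal q) (wMeasure v) < ∞ := by
      rw [hnorm]
      exact ENNReal.rpow_lt_top_of_nonneg (by positivity) (hnt Q E hQ hEQ)
    have h := hC _ (aemeasurable_charFun hE) hfin
    rw [hnorm] at h
    have h1 := mul_meas_ge_le_pow_eLpNorm' (wMeasure v) (p := ENNReal.ofReal q) (by simpa using hq0)
      ENNReal.ofReal_ne_top (measurable_maximalFun volume (charFun E)).aestronglyMeasurable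
      (ENNReal.ofReal η)
    simp only [ENNReal.toReal_ofReal hq0.le, enorm_eq_self] at h1
    have h2 := h1.trans (ENNReal.rpow_le_rpow h hq0.le)
    rw [ENNReal.mul_rpow_of_nonneg _ _ hq0.le, ← ENNReal.rpow_mul, one_div,
      inv_mul_cancel₀ hq0.ne', ENNReal.rpow_one] at h2
    have hq1 : ENNReal.ofReal η ^ q ≠ 0 := (ENNReal.rpow_pos (pos_iff_ne_zero.2 hη0)
      ENNReal.ofReal_ne_top).ne'
    have hq2 : ENNReal.ofReal η ^ q ≠ ∞ :=
      ENNReal.rpow_ne_top_of_nonneg hq0.le ENNReal.ofReal_ne_top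
    push_cast
    rw [ENNReal.coe_toNNReal (ENNReal.inv_ne_top.2 hq1), mul_assoc, mul_comm,
      ← div_eq_mul_inv, ENNReal.le_div_iff_mul_le (Or.inl hq1) (Or.inl hq2), mul_comm,
      ENNReal.coe_rpow_of_nonneg _ hq0.le]
    exact (mul_le_mul' le_rfl (measure_mono (hM Q E hQ hEQ hE hle))).trans h2

/-! ### The bilinear form of a sparse operator -/

theorem IsSparse.countable {η : ℝ} (hη : 0 < η) {S : Set (Set ℝ)} (hS : IsSparse η S) :
    S.Countable := by
  obtain ⟨hcube, E, hE, hdisj⟩ := hS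
  have h := Measure.countable_meas_pos_of_disjoint_iUnion₀ (μ := (volume : Measure ℝ))
    (As := fun Q : S => E Q) (fun Q => (hE Q Q.2).2.1)
    (fun Q R hQR => (hdisj Q.2 R.2 (Subtype.coe_ne_coe.2 hQR)).aedisjoint)
  have huniv : {Q : S | 0 < volume (E Q)} = univ := by
    refine eq_univ_of_forall fun Q => lt_of_lt_of_le ?_ (hE Q Q.2).2.2
    exact ENNReal.mul_pos (by simpa using hη) ((hcube Q Q.2).measure_ne_zero _)
  rw [huniv] at h
  exact countable_univ_iff.1 h

/-- The bilinear form of a sparse operator is controlled by a product of maximal functions. -/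
theorem tsum_sparse_le_lintegral {μ τ ν : Measure ℝ}
    [IsLocallyFiniteMeasure μ] [NullSingletonClass μ] [μ.IsOpenPosMeasure]
    [IsLocallyFiniteMeasure τ] [NullSingletonClass τ] [τ.IsOpenPosMeasure]
    (hν : ν ≪ volume) {K C : ℝ≥0}
    (hK : ∀ Q, IsCube Q → μ Q * τ Q ≤ K * (volume Q * ν Q))
    {S : Set (Set ℝ)} (hSc : S.Countable) (hcube : ∀ Q ∈ S, IsCube Q) {A : Set ℝ → Set ℝ}
    (hA : ∀ Q ∈ S, A Q ⊆ Q ∧ NullMeasurableSet (A Q) volume ∧ ν Q ≤ C * ν (A Q))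
    (hdisj : S.PairwiseDisjoint A) {E F : Set ℝ} (hE : MeasurableSet E) (hF : MeasurableSet F) :
    ∑' Q : S, μ (E ∩ Q) / volume (Q : Set ℝ) * τ (F ∩ Q) ≤
      K * C * ∫⁻ x, maximalFun μ (charFun E) x * maximalFun τ (charFun F) x ∂ν := by
  have := hSc.to_subtype
  have hG : Measurable fun x => maximalFun μ (charFun E) x * maximalFun τ (charFun F) x :=
    (measurable_maximalFun μ _).mul (measurable_maximalFun τ _)
  set G := fun x => maximalFun μ (charFun E) x * maximalFun τ (charFun F) x with hGdef
  calc ∑' Q : S, μ (E ∩ Q) / volume (Q : Set ℝ) * τ (F ∩ Q)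
      ≤ ∑' Q : S, K * C * ∫⁻ x in A Q, G x ∂ν := by
        refine ENNReal.tsum_le_tsum ?_
        rintro ⟨Q, hQS⟩
        have hQ := hcube Q hQS
        obtain ⟨hAQ, hAm, hνA⟩ := hA Q hQS
        simp only
        have hv0 := hQ.measure_ne_zero volume
        have hvt := hQ.measure_ne_top volume
        have hm : μ (E ∩ Q) = μ (E ∩ Q) / μ Q * μ Q :=
          (ENNReal.div_mul_cancel (hQ.measure_ne_zero μ) (hQ.measure_ne_top μ)).symm
        have ht : τ (F ∩ Q) = τ (F ∩ Q) / τ Q * τ Q :=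
          (ENNReal.div_mul_cancel (hQ.measure_ne_zero τ) (hQ.measure_ne_top τ)).symm
        set m := μ (E ∩ Q) / μ Q with hmdef
        set t := τ (F ∩ Q) / τ Q with htdef
        -- The product of the two averages is below `G` on all of `Q`, but it is integrated only
        -- over `A Q`, where disjointness permits summation.
        have hmt : ∀ x ∈ A Q, m * t ≤ G x := by
          intro x hx
          refine mul_le_mul' ?_ ?_
          · have := hQ.le_maximalFun μ (charFun E) (hAQ hx)
            rwa [setLIntegral_enorm_charFun μ hE.nullMeasurableSet] at this
          · have := hQ.le_maximalFun τ (charFun F) (hAQ hx)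
            rwa [setLIntegral_enorm_charFun τ hF.nullMeasurableSet] at this
        calc μ (E ∩ Q) / volume Q * τ (F ∩ Q)
            = m * t * ((μ Q * τ Q) / volume Q) := by
              rw [hm, ht, div_eq_mul_inv, div_eq_mul_inv]; ring
          _ ≤ m * t * (K * ν Q) := by
              refine mul_le_mul' le_rfl (ENNReal.div_le_of_le_mul ?_)
              calc μ Q * τ Q ≤ K * (volume Q * ν Q) := hK Q hQ
                _ = K * ν Q * volume Q := by ring
          _ ≤ m * t * (K * (C * ν (A Q))) := by gcongr
          _ = K * C * ∫⁻ x in A Q, m * t ∂ν := by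
              rw [lintegral_const, Measure.restrict_apply_univ]; ring
          _ ≤ K * C * ∫⁻ x in A Q, G x ∂ν := by
              refine mul_le_mul' le_rfl ?_
              exact setLIntegral_mono hG hmt
    _ = K * C * ∫⁻ x in ⋃ Q : S, A Q, G x ∂ν := by
        rw [ENNReal.tsum_mul_left, lintegral_iUnion₀ (fun Q : S => (hA Q Q.2).2.1.mono_ac hν)]
        exact fun Q R hQR => (hdisj Q.2 R.2 (Subtype.coe_ne_coe.2 hQR)).aedisjoint
    _ ≤ K * C * ∫⁻ x, G x ∂ν := mul_le_mul' le_rfl (setLIntegral_le_lintegral _ _)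

/-! ### From indicator functions to `L^{p,1}` and to the operator bound -/

theorem antitone_distrib (f : ℝ → ℂ) (ν : Measure ℝ) : Antitone (distrib f ν) := by
  intro y z hyz
  refine measure_mono fun x hx => ?_
  have hx' : (z : ℝ≥0∞) < ‖f x‖ₑ := hx
  exact lt_of_le_of_lt (ENNReal.coe_le_coe.2 hyz) hx'

/-- The bound for the bilinear form of a sparse operator on `L^{p,1}` and indicator functions follows
from the bound on pairs of indicator functions. -/
theorem tsum_sparse_le_lorentzOne {μ τ ν : Measure ℝ} (hμ : μ ≪ volume) (hτ : τ ≪ volume)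
    (hν : ν ≪ volume) {p q : ℝ} (hp : 0 < p) {D : ℝ≥0} {S : Set (Set ℝ)} (hSc : S.Countable)
    (hcube : ∀ Q ∈ S, IsCube Q)
    (hD : ∀ E F : Set ℝ, MeasurableSet E → MeasurableSet F → ν E ≠ ∞ → ν F ≠ ∞ →
      ∑' Q : S, μ (E ∩ Q) / volume (Q : Set ℝ) * τ (F ∩ Q) ≤ D * (ν E ^ (1 / p) * ν F ^ (1 / q)))
    {f : ℝ → ℂ} (hf : MemLorentzOne f p ν) {F : Set ℝ} (hF : NullMeasurableSet F volume)
    (hFν : ν F ≠ ∞) :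
    ∑' Q : S, (∫⁻ x in Q, ‖f x‖ₑ ∂μ) / volume (Q : Set ℝ) * τ (F ∩ Q) ≤
      D * lorentzOne f p ν * ν F ^ (1 / q) := by
  have := hSc.to_subtype
  have hanti : ∀ ρ : Measure ℝ, Antitone fun t : ℝ => distrib f ρ t.toNNReal := fun ρ s t hst =>
    antitone_distrib f ρ (Real.toNNReal_le_toNNReal hst)
  have hlayer : ∀ Q : S, ∫⁻ x in Q, ‖f x‖ₑ ∂μ =
      ∫⁻ t in Ioi (0 : ℝ), distrib f (μ.restrict Q) t.toNNReal := by
    intro Q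
    have h := lintegral_eq_lintegral_meas_lt (μ.restrict Q) (f := fun x => ‖f x‖)
      (Eventually.of_forall fun x => norm_nonneg _)
      ((hf.1.mono_ac (Measure.restrict_le_self.absolutelyContinuous.trans hμ)).norm)
    simp only [ofReal_norm] at h
    rw [h]
    refine setLIntegral_congr_fun measurableSet_Ioi fun t ht => ?_
    have ht : (0 : ℝ) < t := ht
    simp only [distrib]
    congr 1
    ext x
    rw [mem_ofPred_eq, mem_ofPred_eq, ← ofReal_norm,
      show ((t.toNNReal : ℝ≥0) : ℝ≥0∞) = ENNReal.ofReal t from rfl,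
      ENNReal.ofReal_lt_ofReal_iff_of_nonneg ht.le]
  -- The bound on indicators needs superlevel sets of finite measure, which finiteness of the
  -- `L^{p,1}` norm provides for almost every height.
  have hfin : ∀ᵐ t ∂(volume.restrict (Ioi (0 : ℝ))), distrib f ν t.toNNReal ^ (1 / p) < ∞ :=
    ae_lt_top ((hanti ν).measurable.pow_const _) hf.2.ne
  have hmeas : ∀ Q : S, Measurable fun t : ℝ =>
      distrib f (μ.restrict Q) t.toNNReal / volume (Q : Set ℝ) * τ (F ∩ Q) := fun Q =>
    ((hanti _).measurable.div_const _).mul_const _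
  obtain ⟨F', hFF', hF', hFae⟩ := hF.exists_measurable_superset_ae_eq
  calc ∑' Q : S, (∫⁻ x in Q, ‖f x‖ₑ ∂μ) / volume (Q : Set ℝ) * τ (F ∩ Q)
      = ∑' Q : S, ∫⁻ t in Ioi (0 : ℝ),
          distrib f (μ.restrict Q) t.toNNReal / volume (Q : Set ℝ) * τ (F ∩ Q) := by
        refine tsum_congr fun Q => ?_
        rw [hlayer Q, lintegral_mul_const _ ((hanti _).measurable.div_const _)]
        simp only [div_eq_mul_inv]
        rw [lintegral_mul_const _ (hanti _).measurable]
    _ = ∫⁻ t in Ioi (0 : ℝ), ∑' Q : S,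
          distrib f (μ.restrict Q) t.toNNReal / volume (Q : Set ℝ) * τ (F ∩ Q) :=
        (lintegral_tsum fun Q => (hmeas Q).aemeasurable).symm
    _ ≤ ∫⁻ t in Ioi (0 : ℝ), D * ν F ^ (1 / q) * distrib f ν t.toNNReal ^ (1 / p) := by
        refine lintegral_mono_ae ?_
        filter_upwards [hfin] with t ht
        have hE : NullMeasurableSet {x | (t.toNNReal : ℝ≥0∞) < ‖f x‖ₑ} volume :=
          nullMeasurableSet_lt aemeasurable_const hf.1.enorm
        obtain ⟨E', hEE', hE', hEae⟩ := hE.exists_measurable_superset_ae_eq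
        have hνE : ν E' = distrib f ν t.toNNReal := measure_congr (hν.ae_eq hEae)
        have hνF : ν F' = ν F := measure_congr (hν.ae_eq hFae)
        have hEt : ν E' ≠ ∞ := by
          rw [hνE]
          intro h
          rw [h, ENNReal.top_rpow_of_pos (by positivity)] at ht
          exact lt_irrefl _ ht
        refine le_trans (le_of_eq ?_) ((hD E' F' hE' hF' hEt (hνF ▸ hFν)).trans (le_of_eq ?_))
        · refine tsum_congr fun Q => ?_
          rw [distrib, Measure.restrict_apply' (hcube Q Q.2).measurableSet,
            measure_congr ((hμ.ae_eq hEae).inter (ae_eq_refl (Q : Set ℝ))),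
            measure_congr ((hτ.ae_eq hFae).inter (ae_eq_refl (Q : Set ℝ)))]
        · rw [hνE, hνF]; ring
    _ = D * lorentzOne f p ν * ν F ^ (1 / q) := by
        rw [lintegral_const_mul _ ((hanti ν).measurable.pow_const _), lorentzOne]
        ring

theorem enorm_setAverage_le (h : ℝ → ℂ) (Q : Set ℝ) :
    ‖⨍ y in Q, h y‖ₑ ≤ (∫⁻ y in Q, ‖h y‖ₑ) / volume Q := by
  rw [setAverage_eq']
  refine (enorm_integral_le_lintegral_enorm _).trans ?_
  rw [lintegral_smul_measure, smul_eq_mul, mul_comm, div_eq_mul_inv]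

/-- A bound on the bilinear form of the sparse operators implies the restricted weak type
inequality. -/
theorem memSpR_of_bilinear {p q : ℝ} (hpq : p.HolderConjugate q) {u v : ℝ → ℝ} (hu : IsWeight u)
    (hv : IsWeight v) (hs : IsWeight fun x => v x / u x)
    (h : ∀ η : ℝ, 0 < η → η < 1 → ∃ D : ℝ≥0, ∀ S : Set (Set ℝ), IsSparse η S →
      ∀ E F : Set ℝ, MeasurableSet E → MeasurableSet F →
        wMeasure v E ≠ ∞ → wMeasure v F ≠ ∞ →
        ∑' Q : S, wMeasure u (E ∩ Q) / volume (Q : Set ℝ) *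
            wMeasure (fun x => v x / u x) (F ∩ Q) ≤
          D * (wMeasure v E ^ (1 / p) * wMeasure v F ^ (1 / q))) :
    MemSpR p u v := by
  refine ⟨hu, hv, fun η hη hη1 => ?_⟩
  obtain ⟨D, hD⟩ := h η hη hη1
  refine ⟨D, fun S hS f hf => ?_⟩
  have hSc := hS.countable hη
  have := hSc.to_subtype
  have hcube := hS.1
  set s : ℝ → ℝ := fun x => v x / u x with hsdef
  set ν := wMeasure v with hν
  set τ := wMeasure s with hτ
  set μ := wMeasure u with hμ
  have hνlf : IsLocallyFiniteMeasure ν := hv.isLocallyFiniteMeasure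
  have hτlf : IsLocallyFiniteMeasure τ := hs.isLocallyFiniteMeasure
  have hτop : τ.IsOpenPosMeasure := hs.isOpenPosMeasure
  have hp : 0 < p := hpq.pos
  have hq : 0 < q := hpq.symm.pos
  have hbil : ∀ F : Set ℝ, NullMeasurableSet F volume → ν F ≠ ∞ →
      ∑' Q : S, (∫⁻ x in Q, ‖f x‖ₑ ∂μ) / volume (Q : Set ℝ) * τ (F ∩ Q) ≤
        D * lorentzOne f p ν * ν F ^ (1 / q) := fun F hF hFν =>
    tsum_sparse_le_lorentzOne (IsWeight.wMeasure_ac u) (IsWeight.wMeasure_ac s)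
      (IsWeight.wMeasure_ac v) hp hSc hcube (hD S hS) hf hF hFν
  have hconst : ∀ F : Set ℝ, ν F ≠ ∞ → D * lorentzOne f p ν * ν F ^ (1 / q) ≠ ∞ := fun F hFν =>
    ENNReal.mul_ne_top (ENNReal.mul_ne_top (by simp) hf.2.ne)
      (ENNReal.rpow_ne_top_of_nonneg (by positivity) hFν)
  have hfu : ∀ Q ∈ S, ∫⁻ x in Q, ‖f x * (u x : ℂ)‖ₑ = ∫⁻ x in Q, ‖f x‖ₑ ∂μ := by
    intro Q hQ
    rw [hu.lintegral_wMeasure hf.1.enorm (hcube Q hQ).measurableSet.nullMeasurableSet]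
    refine lintegral_congr_ae (ae_restrict_of_ae ?_)
    filter_upwards [hu.2] with x hx
    rw [enorm_mul, mul_comm, ← ofReal_norm (u x : ℂ), Complex.norm_of_nonneg hx.le]
  set c : S → ℝ≥0∞ := fun Q => (∫⁻ x in Q, ‖f x‖ₑ ∂μ) / volume (Q : Set ℝ) with hc
  -- The positive majorant of the sparse sum; integrability, convergence and the norm bound all
  -- follow from `∫_F g dτ` for suitable `F`.
  set g : ℝ → ℝ≥0∞ := fun x => ∑' Q : S, c Q * (Q : Set ℝ).indicator 1 x with hg
  have hterm : ∀ x, ∀ Q : S, ‖sparseTerm (fun y => f y * (u y : ℂ)) x Q‖ₑ ≤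
      c Q * (Q : Set ℝ).indicator 1 x := by
    intro x Q
    by_cases hx : x ∈ (Q : Set ℝ)
    · simp only [sparseTerm, indicator_of_mem hx, Pi.one_apply, mul_one, hc]
      rw [← hfu Q Q.2]
      exact enorm_setAverage_le _ _
    · simp [sparseTerm, indicator_of_notMem hx]
  have hind : ∀ Q : S, Measurable fun x => c Q * (Q : Set ℝ).indicator (1 : ℝ → ℝ≥0∞) x :=
    fun Q => (measurable_one.indicator (hcube Q Q.2).measurableSet).const_mul _
  have hgm : Measurable g := Measurable.tsum hind
  have hgF : ∀ F : Set ℝ, NullMeasurableSet F volume → ν F ≠ ∞ →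
      ∫⁻ x in F, g x ∂τ ≤ D * lorentzOne f p ν * ν F ^ (1 / q) := by
    intro F hF hFν
    refine le_trans (le_of_eq ?_) (hbil F hF hFν)
    rw [lintegral_tsum fun Q => (hind Q).aemeasurable]
    refine tsum_congr fun Q => ?_
    have hQm := (hcube Q Q.2).measurableSet
    rw [lintegral_const_mul _ (measurable_one.indicator hQm), lintegral_indicator_one hQm,
      Measure.restrict_apply hQm, inter_comm]
  refine ⟨fun Q hQ => ?_, ?_, ?_⟩
  · have hQc := hcube Q hQ
    have hνQ : ν Q ≠ ∞ := hQc.measure_ne_top ν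
    refine ⟨(hf.1.mul (Complex.measurable_ofReal.comp_aemeasurable
      hu.aemeasurable)).aestronglyMeasurable.restrict, ?_⟩
    rw [HasFiniteIntegral, hfu Q hQ, lt_top_iff_ne_top]
    intro htop
    -- Test with `F = Q`: as `τ Q > 0`, an infinite integral over `Q` would make the form infinite.
    have h1 := (ENNReal.le_tsum (⟨Q, hQ⟩ : S)).trans
      (hbil Q hQc.measurableSet.nullMeasurableSet hνQ)
    simp only at h1
    rw [htop, inter_self, ENNReal.top_div_of_ne_top (hQc.measure_ne_top volume),
      ENNReal.top_mul (hQc.measure_ne_zero τ), top_le_iff] at h1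
    exact hconst Q hνQ h1
  · have hae : ∀ n : ℕ, ∀ᵐ x ∂τ, x ∈ Icc (-(n : ℝ)) n → g x < ∞ := by
      intro n
      rw [← ae_restrict_iff' measurableSet_Icc]
      have hνI : ν (Icc (-(n : ℝ)) n) ≠ ∞ := measure_Icc_lt_top.ne
      exact ae_lt_top hgm (ne_top_of_le_ne_top (hconst _ hνI)
        (hgF _ measurableSet_Icc.nullMeasurableSet hνI))
    have hae' : ∀ᵐ x ∂(volume : Measure ℝ), ∀ n : ℕ, x ∈ Icc (-(n : ℝ)) n → g x < ∞ :=
      hs.ac_wMeasure.ae_le (ae_all_iff.2 hae)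
    filter_upwards [hae'] with x hx
    obtain ⟨n, hn⟩ := exists_nat_ge |x|
    refine Summable.of_enorm (ne_top_of_le_ne_top (hx n (abs_le.1 hn)).ne ?_)
    exact ENNReal.tsum_le_tsum fun Q => hterm x Q
  · refine iSup₂_le fun y hy => ?_
    set H : ℝ → ℝ≥0∞ := fun x => g x / ENNReal.ofReal (u x) with hH
    have hHm : AEMeasurable H volume := hgm.aemeasurable.div hu.aemeasurable.ennreal_ofReal
    -- Truncation to `[-n, n]` makes the measure finite, so that a power of `ν (A n)` can be
    -- cancelled; the full superlevel set is recovered by monotone union.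
    set A : ℕ → Set ℝ := fun n => {x | (y : ℝ≥0∞) < H x} ∩ Icc (-(n : ℝ)) n with hA
    have hAm : ∀ n, NullMeasurableSet (A n) volume := fun n =>
      (nullMeasurableSet_lt aemeasurable_const hHm).inter measurableSet_Icc.nullMeasurableSet
    have hAmono : Monotone A := fun m n hmn => inter_subset_inter_right _
      (Icc_subset_Icc (neg_le_neg (by exact_mod_cast hmn)) (by exact_mod_cast hmn))
    have hAn : ∀ n, y * ν (A n) ^ (1 / p) ≤ D * lorentzOne f p ν := by
      intro n
      have hνA : ν (A n) ≠ ∞ :=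
        ((measure_mono inter_subset_right).trans_lt measure_Icc_lt_top).ne
      rcases eq_or_ne (ν (A n)) 0 with h0 | h0
      · rw [h0, ENNReal.zero_rpow_of_pos (by positivity), mul_zero]
        exact zero_le
      have h1 : y * ν (A n) ≤ ∫⁻ x in A n, H x ∂ν := by
        rw [← setLIntegral_const]
        refine lintegral_mono_ae ?_
        filter_upwards [ae_restrict_mem₀ ((hAm n).mono_ac (IsWeight.wMeasure_ac v))] with x hx
        exact le_of_lt hx.1
      have h2 : ∫⁻ x in A n, H x ∂ν = ∫⁻ x in A n, g x ∂τ := by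
        -- Dividing by `u` and integrating against `v` is integrating against `v/u`.
        rw [hv.lintegral_wMeasure hHm (hAm n), hs.lintegral_wMeasure hgm.aemeasurable (hAm n)]
        refine lintegral_congr_ae (ae_restrict_of_ae ?_)
        filter_upwards [hu.2] with x hx
        simp only [hsdef, hH]
        rw [ENNReal.ofReal_div_of_pos hx, div_eq_mul_inv, div_eq_mul_inv]
        ring
      have h3 := h1.trans (h2.le.trans (hgF (A n) (hAm n) hνA))
      have hq0 : ν (A n) ^ (1 / q) ≠ 0 :=
        (ENNReal.rpow_pos (pos_iff_ne_zero.2 h0) hνA).ne'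
      have hqt : ν (A n) ^ (1 / q) ≠ ∞ := ENNReal.rpow_ne_top_of_nonneg (by positivity) hνA
      rw [← ENNReal.mul_le_mul_iff_left hq0 hqt, mul_assoc, rpow_one_div_mul_rpow_one_div hpq]
      exact h3
    have hsub : ∀ᵐ x ∂ν, x ∈ {x | (y : ℝ≥0∞) <
        ‖sparseOp S (fun y => f y * (u y : ℂ)) x / (u x : ℂ)‖ₑ} → x ∈ ⋃ n, A n := by
      filter_upwards [(IsWeight.wMeasure_ac v).ae_le hu.2] with x hx hyx
      obtain ⟨n, hn⟩ := exists_nat_ge |x|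
      refine mem_iUnion.2 ⟨n, lt_of_lt_of_le hyx ?_, abs_le.1 hn⟩
      have hux : (u x : ℂ) ≠ 0 := by exact_mod_cast hx.ne'
      rw [div_eq_mul_inv, enorm_mul, enorm_inv hux, ← ofReal_norm (u x : ℂ),
        Complex.norm_of_nonneg hx.le, ← div_eq_mul_inv]
      refine ENNReal.div_le_div_right ?_ _
      exact enorm_tsum_le_tsum_enorm.trans (ENNReal.tsum_le_tsum fun Q => hterm x Q)
    have hle : distrib (fun x => sparseOp S (fun y => f y * (u y : ℂ)) x / (u x : ℂ)) ν y ≤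
        ⨆ n, ν (A n) := by
      rw [← hAmono.measure_iUnion]
      exact measure_mono_ae hsub
    have hiff : ∀ a b : ℝ≥0∞, y * a ^ (1 / p) ≤ b ↔ a ≤ (b / y) ^ p := fun a b => by
      rw [mul_comm, ← ENNReal.le_div_iff_mul_le (Or.inl (by simpa using hy.ne'))
        (Or.inl ENNReal.coe_ne_top), one_div, ENNReal.rpow_inv_le_iff hp]
    rw [hiff]
    exact hle.trans (iSup_le fun n => (hiff _ _).1 (hAn n))

/-! ### Assembling the estimates for the weights -/

theorem wMeasure_mul_div_cancel {u : ℝ → ℝ} (hu : IsWeight u) (v : ℝ → ℝ) :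
    wMeasure (fun x => v x / u x * u x) = wMeasure v := by
  refine withDensity_congr_ae ?_
  filter_upwards [hu.2] with x hx
  rw [div_mul_cancel₀ _ hx.ne']

/-- The boundedness of the product of maximal functions, for each of the two pairs of hypotheses. -/
theorem exists_lintegral_maximalFun_mul_le_of_weights {p : ℝ} (hp : 1 < p) {u v : ℝ → ℝ}
    (hu : IsWeight u) (hs : IsWeight fun x => v x / u x)
    (hcond : (MemApRel p u (fun x => v x / u x) ∧
        MemApRestrictedRel (Real.conjExponent p) (fun x => v x / u x) u) ∨
      (MemApRestrictedRel p u (fun x => v x / u x) ∧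
        MemApRel (Real.conjExponent p) (fun x => v x / u x) u)) :
    ∃ C : ℝ≥0, ∀ E F : Set ℝ, MeasurableSet E → MeasurableSet F →
      wMeasure v E ≠ ∞ → wMeasure v F ≠ ∞ →
      ∫⁻ x, maximalFun (wMeasure u) (charFun E) x *
          maximalFun (wMeasure fun x => v x / u x) (charFun F) x ∂(wMeasure v) ≤
        C * (wMeasure v E ^ (1 / p) * wMeasure v F ^ (1 / Real.conjExponent p)) := by
  have hpq := Real.HolderConjugate.conjExponent hp
  have := hu.isLocallyFiniteMeasure
  have := hs.isLocallyFiniteMeasure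
  have := hu.isOpenPosMeasure
  have := hs.isOpenPosMeasure
  have := IsWeight.nullSingletonClass u
  have := IsWeight.nullSingletonClass fun x => v x / u x
  have h1 : wMeasure (fun x => v x / u x * u x) = wMeasure v := wMeasure_mul_div_cancel hu v
  have h2 : wMeasure (fun x => u x * (v x / u x)) = wMeasure v := by
    simp only [mul_comm (u _)]; exact h1
  rcases hcond with ⟨⟨-, -, ha⟩, -, -, hb⟩ | ⟨⟨-, -, ha⟩, -, -, hb⟩
  · rw [h1] at ha
    rw [h2] at hb
    exact exists_lintegral_maximalFun_mul_le hpq ha hb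
  · rw [h1] at ha
    rw [h2] at hb
    -- The second alternative is the first with the roles of `u` and `v/u`, of the two exponents,
    -- and of `E` and `F` exchanged.
    obtain ⟨C, hC⟩ := exists_lintegral_maximalFun_mul_le hpq.symm hb ha
    refine ⟨C, fun E F hE hF hEν hFν => ?_⟩
    have h := hC F E hF hE hFν hEν
    simp only [mul_comm (maximalFun (wMeasure u) _ _)]
    rw [mul_comm (wMeasure v E ^ _)]
    exact h

end SparseWeights

theorem mainTheorem7 (p : ℝ) (hp : 1 < p) (u v : ℝ → ℝ)
    (hu : SparseWeights.IsWeight u) (hv : SparseWeights.IsWeight v)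
    (hvA : SparseWeights.MemAInfty v)
    (hsup : (⨆ (Q : Set ℝ) (_ : SparseWeights.IsCube Q),
      SparseWeights.wMeasure u Q * SparseWeights.wMeasure (fun x => v x / u x) Q /
        (MeasureTheory.volume Q * SparseWeights.wMeasure v Q)) < (⊤ : ENNReal))
    (hcond :
      (SparseWeights.MemApRel p u (fun x => v x / u x) ∧
        SparseWeights.MemApRestrictedRel (Real.conjExponent p) (fun x => v x / u x) u) ∨
      (SparseWeights.MemApRestrictedRel p u (fun x => v x / u x) ∧
        SparseWeights.MemApRel (Real.conjExponent p) (fun x => v x / u x) u)) :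
    SparseWeights.MemSpR p u v := by
  open SparseWeights in
  have hs : IsWeight fun x => v x / u x := by
    rcases hcond with h | h
    exacts [h.1.2.1, h.1.2.1]
  have := hu.isLocallyFiniteMeasure
  have := hs.isLocallyFiniteMeasure
  have := hv.isLocallyFiniteMeasure
  have := hu.isOpenPosMeasure
  have := hs.isOpenPosMeasure
  have := hv.isOpenPosMeasure
  have := IsWeight.nullSingletonClass u
  have := IsWeight.nullSingletonClass fun x => v x / u x
  obtain ⟨C, hC⟩ := exists_lintegral_maximalFun_mul_le_of_weights hp hu hs hcond
  refine memSpR_of_bilinear (Real.HolderConjugate.conjExponent hp) hu hv hs fun η hη hη1 => ?_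
  obtain ⟨C', hC'⟩ := hvA.exists_measure_le hη
  set K := ⨆ (Q : Set ℝ) (_ : IsCube Q),
      wMeasure u Q * wMeasure (fun x => v x / u x) Q / (volume Q * wMeasure v Q) with hKdef
  have hK : ∀ Q, IsCube Q → wMeasure u Q * wMeasure (fun x => v x / u x) Q ≤
      K.toNNReal * (volume Q * wMeasure v Q) := by
    intro Q hQ
    rw [ENNReal.coe_toNNReal hsup.ne, ← ENNReal.div_le_iff
      (mul_ne_zero (hQ.measure_ne_zero _) (hQ.measure_ne_zero _))
      (ENNReal.mul_ne_top (hQ.measure_ne_top _) (hQ.measure_ne_top _))]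
    exact le_iSup₂_of_le (f := fun (Q : Set ℝ) (_ : IsCube Q) =>
      wMeasure u Q * wMeasure (fun x => v x / u x) Q / (volume Q * wMeasure v Q)) Q hQ le_rfl
  -- The factors come from the supremum condition, from `v ∈ A_∞` at sparseness `η`, and from the
  -- product of maximal functions; none depends on `S`.
  refine ⟨K.toNNReal * C' * C, fun S hS E F hE hF hEν hFν => ?_⟩
  have hSc := hS.countable hη
  obtain ⟨hcube, A, hA, hdisj⟩ := hS
  refine (tsum_sparse_le_lintegral (IsWeight.wMeasure_ac v) hK hSc hcube (A := A) (C := C')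
    (fun Q hQ => ⟨(hA Q hQ).1, (hA Q hQ).2.1,
      hC' Q (A Q) (hcube Q hQ) (hA Q hQ).1 (hA Q hQ).2.1 (hA Q hQ).2.2⟩) hdisj hE hF).trans ?_
  push_cast
  rw [mul_assoc _ (C : ENNReal)]
  exact mul_le_mul' le_rfl (hC E F hE hF hEν hFν)
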